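/- Let $\mathbb{D}$ be the space of right-continuous functions $x:[0,1]\to\mathbb{R}$ with left limits, and let $\Lambda$ be the set of strictly increasing continuous functions from $[0,1]$ onto $[0,1]$, with identity $e$. Equip $\mathbb{D}$ with $$d^0_{J_1}(x,y)=\inf_{\lambda\in\Lambda}\Big\{\sup_{s<s'}\Big|\log\frac{\lambda(s')-\lambda(s)}{s'-s}\Big|\vee\sup_{s\in[0,1]}|x(s)-y(\lambda(s))|\Big\}.$$ Let $\mathbb{D}([0,1];\mathbb{D})$ be the space of functions $x:[0,1]\to\mathbb{D}$ that are right-continuous and have left limits with respect to $d^0_{J_1}$, equipped with $$d_{\mathbb{D}}(x,y)=\inf_{\lambda\in\Lambda}\Big\{\sup_{t\in[0,1]}|\lambda(t)-t|\vee\sup_{t\in[0,1]}d^0_{J_1}(x(t),y(\lambda(t)))\Big\}$$ and its Borel $\sigma$-field $\mathcal{D}_{\mathbb{D}}$. Write $x(t)=\{x(t,s);s\in[0,1]\}$ and $\|x\|_{\mathbb{D}}=\sup_{t\in[0,1]}\sup_{s\in[0,1]}|x(t,s)|$. For $\delta\in(0,1)$, define for $x\in\mathbb{D}$ $$w''(x,\delta)=\sup_{s_1\le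 s\le s_2,\ s_2-s_1\le\delta}\big(|x(s)-x(s_1)|\wedge|x(s_2)-x(s)|\big),$$ and for $x\in\mathbb{D}([0,1];\mathbb{D})$ $$w''_{\mathbb{D}}(x,\delta)=\sup_{t_1\le t\le t_2,\ t_2-t_1\le\delta}\big(d^0_{J_1}(x(t),x(t_1))\wedge d^0_{J_1}(x(t_2),x(t))\big).$$ **Theorem.** Let $(P_n)_{n\ge1}$ be a sequence of probability measures on $(\mathbb{D}([0,1];\mathbb{D}),\mathcal{D}_{\mathbb{D}})$. It is tight (for every $\eta>0$ there is a $d_{\mathbb{D}}$-compact set $K$ with $P_n(K)\ge1-\eta$ for all $n$) if and only if the following three conditions hold. (i) $\displaystyle\lim_{a\to\infty}\limsup_{n\to\infty}P_n(\{x:\|x\|_{\mathbb{D}}\ge a\})=0$. (ii') For every $\varepsilon>0$: - (a) $\displaystyle\lim_{\delta\to0}\limsup_{n\to\infty}P_n(\{x:w''(x(t),\delta)\ge\varepsilon\text{ for some }t\in[0,1]\})=0$; - (b) $\displaystyle\lim_{\delta\to0}\limsup_{n\to\infty}P_n(\{x:|x(t,\delta)-x(t,0)|\ge\varepsilon\text{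 for some }t\in[0,1]\})=0$; - (c) $\displaystyle\lim_{\delta\to0}\limsup_{n\to\infty}P_n(\{x:|x(t,1-)-x(t,1-\delta)|\ge\varepsilon\text{ for some }t\in[0,1]\})=0$. (iii') For every $\varepsilon>0$: - (a) $\displaystyle\lim_{\delta\to0}\limsup_{n\to\infty}P_n(\{x:w''_{\mathbb{D}}(x,\delta)\ge\varepsilon\})=0$; - (b) $\displaystyle\lim_{\delta\to0}\limsup_{n\to\infty}P_n(\{x:d^0_{J_1}(x(\delta),x(0))\ge\varepsilon\})=0$; - (c) $\displaystyle\lim_{\delta\to0}\limsup_{n\to\infty}P_n(\{x:d^0_{J_1}(x(1-),x(1-\delta))\ge\varepsilon\})=0$. Here $x(t,1-)$ is the left limit at $1$ of $s\mapsto x(t,s)$, $x(1-)$ is the left limit of $x$ at $1$ with respect to $d^0_{J_1}$, and $P_n$ of an event that is not known to be measurable denotes its outer measure. -/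

import Mathlib

open Filter Topology MeasureTheory
open scoped ENNReal

/-- Functions `x : [0,1] → E` which are right-continuous and have left limits. -/
structure Cadlag (E : Type*) [TopologicalSpace E] where
  toFun : unitInterval → E
  right_continuous : ∀ t, ContinuousWithinAt toFun (Set.Ici t) t
  exists_left_limit : ∀ t, 0 < t → ∃ l, Tendsto toFun (𝓝[<] t) (𝓝 l)

/-- The set `Λ` of time changes: the increasing bijections of `[0,1]` (these are exactly the
strictly increasing continuous functions from `[0,1]` onto `[0,1]`). -/
abbrev TimeChange : Type := unitInterval ≃o unitInterval

namespace TimeChange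

/-- `‖λ - e‖`, the uniform distance of `λ` to the identity. -/
noncomputable def unifSize (l : TimeChange) : ℝ≥0∞ := ⨆ t, edist (l t) t

/-- `‖λ‖⁰ = sup_{s < s'} |log ((λ s' - λ s) / (s' - s))|`. -/
noncomputable def logSize (l : TimeChange) : ℝ≥0∞ :=
  ⨆ (s : unitInterval) (s' : unitInterval) (_ : s < s'),
    ENNReal.ofReal |Real.log (((l s' : ℝ) - (l s : ℝ)) / ((s' : ℝ) - (s : ℝ)))|

/-- The properties of a size function on time changes which make the Skorohod distance built from
it an extended metric. -/
structure IsSize (c : TimeChange → ℝ≥0∞) : Prop where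
  refl : c (OrderIso.refl _) = 0
  symm : ∀ l : TimeChange, c l.symm ≤ c l
  trans : ∀ l m : TimeChange, c (l.trans m) ≤ c l + c m
  control : ∀ ε : ℝ, 0 < ε → ∃ δ : ℝ≥0∞, 0 < δ ∧
    ∀ l : TimeChange, c l < δ → ∀ t, |(l t : ℝ) - t| < ε

theorem isSize_unifSize : IsSize unifSize where
  refl := by simp [unifSize]
  symm l := by
    refine iSup_le fun t => ?_
    have h := le_iSup (fun t => edist (l t) t) (l.symm t)
    simp only [OrderIso.apply_symm_apply] at h
    rw [edist_comm]
    exact h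
  trans l m := by
    refine iSup_le fun t => ?_
    rw [OrderIso.trans_apply]
    calc edist (m (l t)) t ≤ edist (m (l t)) (l t) + edist (l t) t := edist_triangle _ _ _
      _ ≤ unifSize m + unifSize l :=
        add_le_add (le_iSup (fun t => edist (m t) t) (l t)) (le_iSup (fun t => edist (l t) t) t)
      _ = _ := add_comm _ _
  control ε hε := by
    refine ⟨ENNReal.ofReal ε, by simpa using hε, fun l hl t => ?_⟩
    have h : edist (l t) t < ENNReal.ofReal ε :=
      lt_of_le_of_lt (le_iSup (fun t => edist (l t) t) t) hl
    rw [edist_dist, ENNReal.ofReal_lt_ofReal_iff hε, Subtype.dist_eq, Real.dist_eq] at h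
    exact h

theorem le_logSize (l : TimeChange) {s s' : unitInterval} (h : s < s') :
    ENNReal.ofReal |Real.log (((l s' : ℝ) - (l s : ℝ)) / ((s' : ℝ) - (s : ℝ)))| ≤ logSize l :=
  le_iSup_of_le s (le_iSup_of_le s' (le_iSup_of_le h le_rfl))

theorem isSize_logSize : IsSize logSize where
  refl := by
    simp only [logSize, ENNReal.iSup_eq_zero]
    intro s s' h
    have h' : (s' : ℝ) - s ≠ 0 := (sub_pos.2 (Subtype.coe_lt_coe.2 h)).ne'
    simp [div_self h']
  symm l := by
    refine iSup_le fun s => iSup_le fun s' => iSup_le fun h => ?_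
    have h2 := le_logSize l (l.symm.lt_iff_lt.2 h)
    simp only [OrderIso.apply_symm_apply] at h2
    rw [← inv_div, Real.log_inv, abs_neg]
    exact h2
  trans l m := by
    refine iSup_le fun s => iSup_le fun s' => iSup_le fun h => ?_
    have hl := l.lt_iff_lt.2 h
    have hm := m.lt_iff_lt.2 hl
    have a1 : (0 : ℝ) < s' - s := sub_pos.2 (Subtype.coe_lt_coe.2 h)
    have a2 : (0 : ℝ) < l s' - l s := sub_pos.2 (Subtype.coe_lt_coe.2 hl)
    have a3 : (0 : ℝ) < m (l s') - m (l s) := sub_pos.2 (Subtype.coe_lt_coe.2 hm)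
    simp only [OrderIso.trans_apply]
    have e : ((m (l s') : ℝ) - m (l s)) / ((s' : ℝ) - s)
        = (((l s' : ℝ) - l s) / ((s' : ℝ) - s)) * (((m (l s') : ℝ) - m (l s)) / ((l s' : ℝ) - l s)) := by
      field_simp
    rw [e, Real.log_mul (div_pos a2 a1).ne' (div_pos a3 a2).ne']
    refine (ENNReal.ofReal_le_ofReal (abs_add_le _ _)).trans ?_
    rw [ENNReal.ofReal_add (abs_nonneg _) (abs_nonneg _)]
    exact add_le_add (le_logSize l h) (le_logSize m hl)
  control ε hε := by
    have hpos : 0 < Real.log (1 + ε) := Real.log_pos (by linarith)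
    refine ⟨ENNReal.ofReal (Real.log (1 + ε)), by simpa using hpos, fun l hl t => ?_⟩
    rcases eq_or_ne t 0 with rfl | ht
    · have : l 0 = 0 := l.map_bot
      simpa [this] using hε
    have ht0 : (0 : unitInterval) < t := unitInterval.pos_iff_ne_zero.2 ht
    have h := lt_of_le_of_lt (le_logSize l ht0) hl
    have hl0 : l 0 = 0 := l.map_bot
    have a1 : (0 : ℝ) < t := ht0
    have a2 : (0 : ℝ) < l t := by
      have := l.lt_iff_lt.2 ht0
      rw [hl0] at this
      exact this
    have a3 : (t : ℝ) ≤ 1 := t.2.2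
    rw [ENNReal.ofReal_lt_ofReal_iff hpos, hl0] at h
    simp only [Set.Icc.coe_zero, sub_zero] at h
    rw [abs_lt, ← Real.log_inv] at h
    have b1 := (Real.log_lt_log_iff (div_pos a2 a1) (by linarith)).1 h.2
    have b2 := (Real.log_lt_log_iff (by positivity) (div_pos a2 a1)).1 h.1
    rw [div_lt_iff₀ a1] at b1
    rw [lt_div_iff₀ a1, inv_mul_lt_iff₀ (by linarith)] at b2
    have a4 : (l t : ℝ) ≤ 1 := (l t).2.2
    rw [abs_lt]
    constructor <;> nlinarith

end TimeChange

namespace Cadlag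

section Basic

variable {E : Type*} [TopologicalSpace E]

instance : FunLike (Cadlag E) unitInterval E where
  coe := Cadlag.toFun
  coe_injective := by
    intro x y h
    cases x
    cases y
    congr

/-- The left limit `x(1-)`. -/
noncomputable def leftLimOne (x : Cadlag E) : E :=
  Classical.choose (x.exists_left_limit 1 zero_lt_one)

end Basic

/-- The Skorohod distance attached to a size function `c` on the time changes:
`inf_λ (c λ ∨ sup_t d(x t, y (λ t)))`, as an element of `[0,∞]`. -/
noncomputable def skorohodEDist {E : Type*} [PseudoEMetricSpace E] (c : TimeChange → ℝ≥0∞)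
    (x y : Cadlag E) : ℝ≥0∞ :=
  ⨅ l : TimeChange, c l ⊔ ⨆ t, edist (x t) (y (l t))

theorem eq_of_skorohodEDist_eq_zero {E : Type*} [EMetricSpace E] {c : TimeChange → ℝ≥0∞}
    (hc : TimeChange.IsSize c) {x y : Cadlag E} (h : skorohodEDist c x y = 0) : x = y := by
  have hex : ∀ n : ℕ, ∃ l : TimeChange,
      c l < ((n : ℝ≥0∞) + 1)⁻¹ ∧ ∀ t, edist (x t) (y (l t)) < ((n : ℝ≥0∞) + 1)⁻¹ := by
    intro n
    have hn : skorohodEDist c x y < ((n : ℝ≥0∞) + 1)⁻¹ := by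
      rw [h, ENNReal.inv_pos]
      simp
    obtain ⟨l, hl⟩ := iInf_lt_iff.1 hn
    rw [sup_lt_iff] at hl
    exact ⟨l, hl.1, fun t => lt_of_le_of_lt (le_iSup (fun t => edist (x t) (y (l t))) t) hl.2⟩
  choose l hl hxy using hex
  have hu : Tendsto (fun n : ℕ => ((n : ℝ≥0∞) + 1)⁻¹) atTop (𝓝 0) := by
    have := (ENNReal.tendsto_inv_nat_nhds_zero).comp (tendsto_add_atTop_nat 1)
    simpa [Function.comp_def] using this
  have hctl : ∀ ε : ℝ, 0 < ε → ∀ᶠ n in atTop, ∀ t, |(l n t : ℝ) - t| < ε := by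
    intro ε hε
    obtain ⟨δ, hδ, H⟩ := hc.control ε hε
    filter_upwards [hu.eventually (gt_mem_nhds hδ)] with n hn
    exact H _ ((hl n).trans hn)
  refine DFunLike.ext _ _ fun t => ?_
  have h1 : Tendsto (fun n => l n t) atTop (𝓝 t) := by
    rw [Metric.tendsto_nhds]
    intro ε hε
    filter_upwards [hctl ε hε] with n hn
    exact hn t
  have h2 : Tendsto (fun n => (l n).symm t) atTop (𝓝 t) := by
    rw [Metric.tendsto_nhds]
    intro ε hε
    filter_upwards [hctl ε hε] with n hn
    have := hn ((l n).symm t)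
    rw [OrderIso.apply_symm_apply, abs_sub_comm] at this
    exact this
  have h3 : Tendsto (fun n => y (l n t)) atTop (𝓝 (x t)) := by
    rw [tendsto_iff_edist_tendsto_0]
    refine tendsto_of_tendsto_of_tendsto_of_le_of_le tendsto_const_nhds hu (fun _ => zero_le) ?_
    intro n
    simp only
    rw [edist_comm]
    exact (hxy n t).le
  have h4 : Tendsto (fun n => x ((l n).symm t)) atTop (𝓝 (y t)) := by
    rw [tendsto_iff_edist_tendsto_0]
    refine tendsto_of_tendsto_of_tendsto_of_le_of_le tendsto_const_nhds hu (fun _ => zero_le) ?_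
    intro n
    have := (hxy n ((l n).symm t)).le
    rwa [OrderIso.apply_symm_apply] at this
  by_cases hf : ∃ᶠ n in atTop, t ≤ l n t
  · have : NeBot (atTop ⊓ 𝓟 {n | t ≤ l n t}) := frequently_iff_neBot.1 hf
    have h5 : Tendsto (fun n => l n t) (atTop ⊓ 𝓟 {n | t ≤ l n t}) (𝓝[≥] t) :=
      tendsto_nhdsWithin_iff.2 ⟨h1.mono_left inf_le_left, eventually_inf_principal.2
        (Eventually.of_forall fun n hn => hn)⟩
    exact tendsto_nhds_unique (h3.mono_left inf_le_left) ((y.right_continuous t).tendsto.comp h5)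
  · have h5 : Tendsto (fun n => (l n).symm t) atTop (𝓝[≥] t) := by
      refine tendsto_nhdsWithin_iff.2 ⟨h2, ?_⟩
      filter_upwards [not_frequently.1 hf] with n hn
      have := (l n).symm.lt_iff_lt.2 (not_le.1 hn)
      rw [OrderIso.symm_apply_apply] at this
      exact this.le
    exact tendsto_nhds_unique ((x.right_continuous t).tendsto.comp h5) h4

/-- The Skorohod distance attached to a size function, as an extended metric. -/
noncomputable abbrev skorohodEMetric {E : Type*} [EMetricSpace E] (c : TimeChange → ℝ≥0∞)
    (hc : TimeChange.IsSize c) : EMetricSpace (Cadlag E) where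
  edist := skorohodEDist c
  edist_self x := by
    refine le_antisymm ((iInf_le _ (OrderIso.refl _)).trans ?_) zero_le
    simp [hc.refl]
  edist_comm := by
    have key : ∀ x y : Cadlag E, skorohodEDist c x y ≤ skorohodEDist c y x := by
      intro x y
      refine le_iInf fun l => (iInf_le _ l.symm).trans ?_
      refine sup_le_sup (hc.symm l) (iSup_le fun t => ?_)
      have h := le_iSup (fun t => edist (y t) (x (l t))) (l.symm t)
      simp only [OrderIso.apply_symm_apply] at h
      rw [edist_comm]
      exact h
    exact fun x y => le_antisymm (key x y) (key y x)
  edist_triangle x y z := by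
    refine ENNReal.le_of_forall_pos_le_add fun ε hε hfin => ?_
    have hε2 : ((ε : ℝ≥0∞) / 2) ≠ 0 := by simpa using hε.ne'
    obtain ⟨l, hl⟩ := iInf_lt_iff.1 (ENNReal.lt_add_right
      (ENNReal.add_lt_top.1 hfin).1.ne hε2)
    obtain ⟨m, hm⟩ := iInf_lt_iff.1 (ENNReal.lt_add_right
      (ENNReal.add_lt_top.1 hfin).2.ne hε2)
    have h : skorohodEDist c x z ≤ (c l ⊔ ⨆ t, edist (x t) (y (l t))) +
        (c m ⊔ ⨆ t, edist (y t) (z (m t))) := by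
      refine (iInf_le _ (l.trans m)).trans (sup_le ?_ (iSup_le fun t => ?_))
      · exact (hc.trans l m).trans (add_le_add le_sup_left le_sup_left)
      · rw [OrderIso.trans_apply]
        refine (edist_triangle _ (y (l t)) _).trans (add_le_add ?_ ?_)
        · exact (le_iSup (fun t => edist (x t) (y (l t))) t).trans le_sup_right
        · exact (le_iSup (fun t => edist (y t) (z (m t))) (l t)).trans le_sup_right
    refine h.trans ((add_le_add hl.le hm.le).trans (le_of_eq ?_))
    rw [add_add_add_comm, ENNReal.add_halves]
    rfl
  eq_of_edist_eq_zero := fun h => eq_of_skorohodEDist_eq_zero hc h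

/-- The modulus `w''(x, δ) = sup { d(x t, x t₁) ∧ d(x t₂, x t) : t₁ ≤ t ≤ t₂, t₂ - t₁ ≤ δ }`. -/
noncomputable def wSecond {E : Type*} [PseudoEMetricSpace E] (x : Cadlag E)
    (δ : unitInterval) : ℝ≥0∞ :=
  ⨆ (t₁ : unitInterval) (t : unitInterval) (t₂ : unitInterval)
    (_ : t₁ ≤ t ∧ t ≤ t₂ ∧ (t₂ : ℝ) - t₁ ≤ δ),
    edist (x t) (x t₁) ⊓ edist (x t₂) (x t)

end Cadlag

/-- The Skorohod space `D` of real càdlàg functions on `[0,1]`. -/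
abbrev SkD : Type := Cadlag ℝ

/-- `D` carries the distance `d⁰_{J₁}`, which defines the `J₁` topology. -/
noncomputable instance SkD.instEMetricSpace : EMetricSpace SkD :=
  Cadlag.skorohodEMetric TimeChange.logSize TimeChange.isSize_logSize

/-- The space `D([0,1]; D)` of `D`-valued functions on `[0,1]` which are right-continuous and have
left limits with respect to `J₁`. -/
abbrev SkDD : Type := Cadlag SkD

/-- `D([0,1]; D)` carries the distance
`d_D(x,y) = inf_λ (‖λ - e‖ ∨ sup_t d⁰_{J₁}(x t, y (λ t)))`. -/
noncomputable instance SkDD.instEMetricSpace : EMetricSpace SkDD :=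
  Cadlag.skorohodEMetric TimeChange.unifSize TimeChange.isSize_unifSize

/-- The Borel σ-field of `(D([0,1]; D), d_D)`. -/
noncomputable instance SkDD.instMeasurableSpace : MeasurableSpace SkDD := borel SkDD

instance SkDD.instBorelSpace : BorelSpace SkDD := ⟨rfl⟩

/-- The super-uniform norm `sup_t sup_s |x(t,s)|`. -/
noncomputable def SkDD.supNorm (x : SkDD) : ℝ≥0∞ := ⨆ t, ⨆ s, ‖x t s‖ₑ

/-! Both directions pass through partitions: `HasPartition ε δ` asks for a grid with gaps at least
`δ`, up to its arrival at 1, on whose half-open cells the oscillation about the left node is at most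
`ε`.

Partitions give compactness. Take an ultrafilter of càdlàg functions with values in one compact set
and, at each scale `ε`, partitions of a common mesh. Their nodes, the values at the nodes and the
values at each fixed time all converge along it. The right limits of the pointwise limit define a
càdlàg function, and the piecewise linear time change between limit nodes and nodes shows
convergence for the logarithmic distance (`exists_tendsto_of_hasPartition`), hence also for the
uniform one. The criterion is used twice: for the real functions `x t`, with an interval as compact
set, and then for `x` itself, with the closure in `SkD` of all the values as compact set.

The three moduli give partitions. If `w''` is below `ε`, jumps larger than `4ε` are `δ`-separated
and the end conditions keep them away from 0 and from the left of 1. A grid through all of them has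
oscillation at most `6ε` (`hasPartition_of_wSecond_lt`).

Measurability of the events is never needed. All bad events vanish locally uniformly: each point has
a ball that eventually misses them (`LocallyUniformly`). Compact sets are then eventually missed as
well, which proves necessity. For sufficiency the hypotheses only bound large `n`. For each
remaining `n`, the closures of the decreasing bad events are measurable with empty intersection, so
continuity from above applies (`exists_forall_measure_le_of_locallyUniformly`), and no Polishness is
used. Countably many such bounds, with summable errors, cut out a relatively compact set. -/

/-! ### Grids of `[0,1]` -/

/-- A sequence of nodes in `[0,1]` which starts at `0`, increases by at least `δ` at each step until
it reaches `1`, and stays there. -/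
structure IsGrid (δ : ℝ) (τ : ℕ → unitInterval) : Prop where
  zero : τ 0 = 0
  mono : Monotone τ
  gap : ∀ i, τ i = 1 ∨ (τ i : ℝ) + δ ≤ τ (i + 1)

namespace IsGrid

theorem mul_le {δ : ℝ} {τ : ℕ → unitInterval} (h : IsGrid δ τ) (i : ℕ) :
    τ i = 1 ∨ i * δ ≤ τ i := by
  induction i with
  | zero => right; simp [h.zero]
  | succ i ih =>
    rcases h.gap i with h1 | h1
    · exact Or.inl (le_antisymm unitInterval.le_one' (h1 ▸ h.mono i.le_succ))
    rcases ih with h2 | h2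
    · exact Or.inl (le_antisymm unitInterval.le_one' (h2 ▸ h.mono i.le_succ))
    · right
      push_cast
      linarith

theorem eq_one {δ : ℝ} {τ : ℕ → unitInterval} (h : IsGrid δ τ) {N : ℕ} (hN : 1 < N * δ) :
    τ N = 1 := by
  rcases h.mul_le N with h1 | h1
  · exact h1
  · exact absurd (hN.trans_le h1) (not_lt.2 (τ N).2.2)

theorem exists_mem_Ico {δ : ℝ} {τ : ℕ → unitInterval} (h : IsGrid δ τ) {N : ℕ} (hN : τ N = 1)
    {t : unitInterval} (ht : t < 1) : ∃ i < N, τ i ≤ t ∧ t < τ (i + 1) := by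
  classical
  have hex : ∃ i, t < τ i := ⟨N, hN ▸ ht⟩
  have hpos : Nat.find hex ≠ 0 := fun h0 => by
    have := Nat.find_spec hex
    rw [h0, h.zero] at this
    exact not_lt.2 unitInterval.nonneg' this
  obtain ⟨i, hi⟩ := Nat.exists_eq_succ_of_ne_zero hpos
  have hle : Nat.find hex ≤ N := Nat.find_min' hex (hN ▸ ht)
  refine ⟨i, by omega, not_lt.1 (Nat.find_min hex (by omega)), ?_⟩
  have := Nat.find_spec hex
  rwa [hi] at this

theorem exists_mem_Ioc {δ : ℝ} {τ : ℕ → unitInterval} (h : IsGrid δ τ) {N : ℕ} (hN : τ N = 1)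
    {t : unitInterval} (ht : 0 < t) : ∃ i < N, τ i < t ∧ t ≤ τ (i + 1) := by
  classical
  have hex : ∃ i, t ≤ τ i := ⟨N, hN ▸ unitInterval.le_one'⟩
  have hpos : Nat.find hex ≠ 0 := fun h0 => by
    have := Nat.find_spec hex
    rw [h0, h.zero] at this
    exact not_lt.2 this ht
  obtain ⟨i, hi⟩ := Nat.exists_eq_succ_of_ne_zero hpos
  have hle : Nat.find hex ≤ N := Nat.find_min' hex (hN ▸ unitInterval.le_one')
  refine ⟨i, by omega, not_le.1 (Nat.find_min hex (by omega)), ?_⟩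
  have := Nat.find_spec hex
  rwa [hi] at this

theorem of_le {δ δ' : ℝ} {τ : ℕ → unitInterval} (h : IsGrid δ τ) (hδ : δ' ≤ δ) : IsGrid δ' τ :=
  ⟨h.zero, h.mono, fun i => (h.gap i).imp_right fun h => by linarith⟩

theorem of_tendsto {ι : Type*} {F : Filter ι} [NeBot F] {δ : ℝ}
    {τ : ι → ℕ → unitInterval} {σ : ℕ → unitInterval} (hτ : ∀ᶠ y in F, IsGrid δ (τ y))
    (hσ : ∀ i, Tendsto (fun y => τ y i) F (𝓝 (σ i))) : IsGrid δ σ where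
  zero := tendsto_nhds_unique (hσ 0)
    (tendsto_const_nhds.congr' (hτ.mono fun _ h => h.zero.symm))
  mono := fun i j hij => le_of_tendsto_of_tendsto (hσ i) (hσ j) (hτ.mono fun _ h => h.mono hij)
  gap := fun i => by
    have hc : ∀ j, Tendsto (fun y => (τ y j : ℝ)) F (𝓝 (σ j : ℝ)) := fun j =>
      (continuous_subtype_val.tendsto _).comp (hσ j)
    by_cases hf : ∃ᶠ y in F, τ y i = 1
    · exact Or.inl (isClosed_singleton.mem_of_frequently_of_tendsto hf (hσ i))
    · refine Or.inr (le_of_tendsto_of_tendsto ((hc i).add_const δ) (hc (i + 1)) ?_)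
      filter_upwards [hτ, not_frequently.1 hf] with y hy hy1
      exact (hy.gap i).resolve_left hy1

/-- A node of such a grid is either 1 or at most `1 - δ`, so it cannot approach 1 without reaching
it. This lets degenerate cells be matched exactly, as a finite logarithmic size requires. -/
theorem eventually_eq_one {ι : Type*} {F : Filter ι} {δ : ℝ} (hδ : 0 < δ)
    {τ : ι → ℕ → unitInterval} {i : ℕ} (hτ : ∀ᶠ y in F, IsGrid δ (τ y))
    (hi : Tendsto (fun y => τ y i) F (𝓝 1)) : ∀ᶠ y in F, τ y i = 1 := by
  have hc : Tendsto (fun y => (τ y i : ℝ)) F (𝓝 ((1 : unitInterval) : ℝ)) :=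
    (continuous_subtype_val.tendsto _).comp hi
  have : (1 - δ : ℝ) < ((1 : unitInterval) : ℝ) := by simpa using hδ
  filter_upwards [hτ, hc.eventually (lt_mem_nhds this)] with y hy hy1
  refine (hy.gap i).resolve_right fun h => ?_
  have := (τ y (i + 1)).2.2
  linarith

end IsGrid

/-! ### Piecewise linear time changes -/

namespace TimeChange

theorem map_zero (l : TimeChange) : l 0 = 0 := l.map_bot

theorem map_one (l : TimeChange) : l 1 = 1 := l.map_top

/-- A continuous self-map of `[0,1]` fixing the end points whose difference quotients lie between
`exp (-η)` and `exp η` is a time change of logarithmic size at most `η`. -/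
theorem exists_of_difference_quotients {f : ℝ → ℝ} {η : ℝ} (hf : Continuous f) (h0 : f 0 = 0)
    (h1 : f 1 = 1)
    (hlow : ∀ s s' : ℝ, s ≤ s' → 0 ≤ s → s' ≤ 1 → Real.exp (-η) * (s' - s) ≤ f s' - f s)
    (hup : ∀ s s' : ℝ, s ≤ s' → 0 ≤ s → s' ≤ 1 → f s' - f s ≤ Real.exp η * (s' - s)) :
    ∃ l : TimeChange, logSize l ≤ ENNReal.ofReal η ∧ ∀ t, (l t : ℝ) = f t := by
  have hlt : ∀ s s' : unitInterval, s < s' → f s < f s' := by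
    intro s s' h
    have h' : (0 : ℝ) < s' - s := sub_pos.2 (Subtype.coe_lt_coe.2 h)
    have := hlow s s' (by linarith) s.2.1 s'.2.2
    have := mul_pos (Real.exp_pos (-η)) h'
    linarith
  have hle : ∀ s s' : unitInterval, s ≤ s' → f s ≤ f s' := fun s s' h =>
    h.eq_or_lt.elim (fun h => h ▸ le_rfl) fun h => (hlt s s' h).le
  have hmem : ∀ t : unitInterval, f t ∈ Set.Icc (0 : ℝ) 1 := fun t =>
    ⟨by simpa [h0] using hle 0 t unitInterval.nonneg', by simpa [h1] using hle t 1 unitInterval.le_one'⟩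
  let g : unitInterval → unitInterval := fun t => ⟨f t, hmem t⟩
  have hg : StrictMono g := fun s s' h => hlt s s' h
  have hsurj : Function.Surjective g := by
    intro u
    have := intermediate_value_Icc zero_le_one hf.continuousOn (a := (0 : ℝ)) (b := 1)
    obtain ⟨t, ht, htu⟩ := this (show (u : ℝ) ∈ Set.Icc (f 0) (f 1) by rw [h0, h1]; exact u.2)
    exact ⟨⟨t, ht⟩, Subtype.ext htu⟩
  refine ⟨hg.orderIsoOfSurjective g hsurj, ?_, fun t => rfl⟩
  refine iSup_le fun s => iSup_le fun s' => iSup_le fun h => ENNReal.ofReal_le_ofReal ?_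
  have h' : (0 : ℝ) < s' - s := sub_pos.2 (Subtype.coe_lt_coe.2 h)
  have a1 := hlow s s' (by linarith) s.2.1 s'.2.2
  have a2 := hup s s' (by linarith) s.2.1 s'.2.2
  have a3 : (0 : ℝ) < f s' - f s := sub_pos.2 (hlt s s' h)
  change |Real.log ((f s' - f s) / ((s' : ℝ) - s))| ≤ η
  rw [abs_le, Real.le_log_iff_exp_le (div_pos a3 h'), Real.log_le_iff_le_exp (div_pos a3 h'),
    le_div_iff₀ h', div_le_iff₀ h']
  exact ⟨a1, a2⟩

/-- The piecewise linear time change which maps the nodes `τ i` to the nodes `σ i`. -/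
theorem exists_map_nodes {τ σ : ℕ → unitInterval} (hτ : Monotone τ) (hτ0 : τ 0 = 0)
    (hσ0 : σ 0 = 0) {N : ℕ} (hτN : τ N = 1) (hσN : σ N = 1) {η : ℝ}
    (hlow : ∀ i < N, Real.exp (-η) * ((τ (i + 1) : ℝ) - τ i) ≤ σ (i + 1) - σ i)
    (hup : ∀ i < N, (σ (i + 1) : ℝ) - σ i ≤ Real.exp η * ((τ (i + 1) : ℝ) - τ i)) :
    ∃ l : TimeChange, logSize l ≤ ENNReal.ofReal η ∧ ∀ i ≤ N, l (τ i) = σ i := by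
  have hr : ∀ i, ∃ r : ℝ, i < N → (σ (i + 1) : ℝ) - σ i = r * ((τ (i + 1) : ℝ) - τ i) ∧
      (0 < (τ (i + 1) : ℝ) - τ i → Real.exp (-η) ≤ r ∧ r ≤ Real.exp η) := by
    intro i
    -- The slope on the `i`-th cell. On a degenerate cell it is the default 0, which is harmless
    -- because `hlow` and `hup` force the target cell to be degenerate too.
    refine ⟨((σ (i + 1) : ℝ) - σ i) / ((τ (i + 1) : ℝ) - τ i), fun hi => ⟨?_, fun hp => ?_⟩⟩
    · have h0 : (0 : ℝ) ≤ (τ (i + 1) : ℝ) - τ i := sub_nonneg.2 (hτ i.le_succ)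
      rcases h0.eq_or_lt with h | h
      · have b1 := hlow i hi
        have b2 := hup i hi
        rw [← h] at b1 b2 ⊢
        simp only [mul_zero] at b1 b2 ⊢
        exact le_antisymm b2 b1
      · field_simp
    · rw [le_div_iff₀ hp, div_le_iff₀ hp]
      exact ⟨hlow i hi, hup i hi⟩
  choose r hr using hr
  -- For `s ≥ 0`, `D i s` is the length of `[0, s] ∩ [τ i, τ (i + 1)]`. On `[0,1]` these lengths sum
  -- to `s`, so the difference quotients of `∑ r i * D i` are averages of slopes.
  set D : ℕ → ℝ → ℝ := fun i s => min s (τ (i + 1)) - min s (τ i) with hD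
  have hτ' : ∀ i, (τ i : ℝ) ≤ τ (i + 1) := fun i => hτ i.le_succ
  have hDmono : ∀ i s s', s ≤ s' → 0 ≤ D i s' - D i s := by
    intro i s s' h
    have := hτ' i
    simp only [hD]
    rcases le_total s (τ i) with h1 | h1 <;> rcases le_total s' (τ i) with h2 | h2 <;>
    rcases le_total s (τ (i + 1)) with h3 | h3 <;> rcases le_total s' (τ (i + 1)) with h4 | h4 <;>
    simp only [h1, h2, h3, h4, min_eq_left, min_eq_right] <;> linarith
  have hDsum : ∀ s, 0 ≤ s → s ≤ 1 → ∑ i ∈ Finset.range N, D i s = s := by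
    intro s h0 h1
    simp only [hD]
    rw [Finset.sum_range_sub (fun i => min s (τ i : ℝ)), hτN, hτ0]
    simp [h0, h1]
  have hDzero : ∀ i s, (τ (i + 1) : ℝ) - τ i = 0 → D i s = 0 := fun i s h => by
    simp only [hD]
    rw [sub_eq_zero.1 h, sub_self]
  have hpos : ∀ i, 0 < (τ (i + 1) : ℝ) - τ i ∨ (τ (i + 1) : ℝ) - τ i = 0 := fun i =>
    (sub_nonneg.2 (hτ' i)).lt_or_eq.imp_right Eq.symm
  set f : ℝ → ℝ := fun s => ∑ i ∈ Finset.range N, r i * D i s with hf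
  have hfnode : ∀ j ≤ N, f (τ j) = σ j := by
    intro j hj
    have hterm : ∀ i, i < N → r i * D i (τ j) = if i < j then (σ (i + 1) : ℝ) - σ i else 0 := by
      intro i hi
      split_ifs with h
      · rw [(hr i hi).1]
        have e1 : (τ (i + 1) : ℝ) ≤ τ j := hτ (show i + 1 ≤ j from h)
        simp only [hD, min_eq_right e1, min_eq_right ((hτ' i).trans e1)]
      · have e1 : (τ j : ℝ) ≤ τ i := hτ (not_lt.1 h)
        simp only [hD, min_eq_left e1, min_eq_left (e1.trans (hτ' i)), sub_self, mul_zero]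
    simp only [hf]
    rw [Finset.sum_congr rfl fun i hi => hterm i (Finset.mem_range.1 hi), ← Finset.sum_filter]
    have : (Finset.range N).filter (fun i => i < j) = Finset.range j := by
      ext i
      simp only [Finset.mem_filter, Finset.mem_range]
      omega
    rw [this, Finset.sum_range_sub (fun i => (σ i : ℝ)), hσ0]
    simp
  have hdiff : ∀ s s', f s' - f s = ∑ i ∈ Finset.range N, r i * (D i s' - D i s) := by
    intro s s'
    simp only [hf, ← Finset.sum_sub_distrib, mul_sub]
  have hDdiff : ∀ s s' : ℝ, s ≤ s' → 0 ≤ s → s' ≤ 1 →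
      s' - s = ∑ i ∈ Finset.range N, (D i s' - D i s) := by
    intro s s' h h0 h1
    rw [Finset.sum_sub_distrib, hDsum s h0 (h.trans h1), hDsum s' (h0.trans h) h1]
  obtain ⟨l, hl, hlf⟩ := exists_of_difference_quotients (f := f) (η := η)
    (by simp only [hf, hD]; fun_prop)
    (by simpa [hτ0, hσ0] using hfnode 0 N.zero_le) (by simpa [hτN, hσN] using hfnode N le_rfl)
    (fun s s' h h0 h1 => by
      rw [hdiff, hDdiff s s' h h0 h1, Finset.mul_sum]
      refine Finset.sum_le_sum fun i hi => ?_
      rcases hpos i with hp | hp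
      · exact mul_le_mul_of_nonneg_right ((hr i (Finset.mem_range.1 hi)).2 hp).1 (hDmono i s s' h)
      · simp [hDzero i _ hp])
    (fun s s' h h0 h1 => by
      rw [hdiff, hDdiff s s' h h0 h1, Finset.mul_sum]
      refine Finset.sum_le_sum fun i hi => ?_
      rcases hpos i with hp | hp
      · exact mul_le_mul_of_nonneg_right ((hr i (Finset.mem_range.1 hi)).2 hp).2 (hDmono i s s' h)
      · simp [hDzero i _ hp])
  exact ⟨l, hl, fun i hi => Subtype.ext ((hlf _).trans (hfnode i hi))⟩

end TimeChange

/-! ### Compactness of closures through ultrafilters -/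

/-- An ultrafilter `G` on the closure is shadowed by an ultrafilter `F` on `s` containing all
neighbourhoods of members of `G`. By regularity a limit of `F` is a limit of `G`. -/
theorem isCompact_closure_of_ultrafilter {X : Type*} [TopologicalSpace X] [RegularSpace X]
    {s : Set X} (h : ∀ F : Ultrafilter X, s ∈ F → ∃ x, (F : Filter X) ≤ 𝓝 x) :
    IsCompact (closure s) := by
  rw [isCompact_iff_ultrafilter_le_nhds']
  intro G hG
  have hmem : ∀ w, w ∈ (G : Filter X).lift nhdsSet ↔ ∃ u ∈ (G : Filter X), w ∈ 𝓝ˢ u := fun w =>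
    mem_lift_sets monotone_nhdsSet
  have hne : NeBot ((G : Filter X).lift nhdsSet ⊓ 𝓟 s) := by
    rw [inf_principal_neBot_iff]
    intro v hv
    obtain ⟨u, huG, huv⟩ := (hmem v).1 hv
    obtain ⟨z, hzu, hzs⟩ := G.nonempty_of_mem (inter_mem huG hG)
    exact mem_closure_iff_nhds.1 hzs v (mem_nhdsSet_iff_forall.1 huv z hzu)
  have hF : (Ultrafilter.of ((G : Filter X).lift nhdsSet ⊓ 𝓟 s) : Filter X) ≤ _ :=
    Ultrafilter.of_le _
  generalize Ultrafilter.of ((G : Filter X).lift nhdsSet ⊓ 𝓟 s) = F at hF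
  have hFs : s ∈ F := hF (mem_inf_of_right (mem_principal_self s))
  obtain ⟨x, hx⟩ := h F hFs
  refine ⟨x, mem_closure_iff_ultrafilter.2 ⟨F, hFs, hx⟩, fun w hw => ?_⟩
  obtain ⟨V, ⟨hVx, hVc⟩, hVw⟩ := (closed_nhds_basis x).mem_iff.1 hw
  refine mem_of_superset (?_ : V ∈ G) hVw
  by_contra hV
  -- The complement of the closed neighbourhood `V` is open, hence a neighbourhood of itself, and so
  -- passes from `G` to `F`.
  have h1 : Vᶜ ∈ F := hF (mem_inf_of_left ((hmem _).2
    ⟨Vᶜ, Ultrafilter.compl_mem_iff_notMem.2 hV, hVc.isOpen_compl.mem_nhdsSet_self⟩))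
  exact Ultrafilter.compl_mem_iff_notMem.1 h1 (hx hVx)

theorem exists_add_add_lt {ε : ℝ≥0∞} (hε : 0 < ε) : ∃ r : ℝ≥0∞, 0 < r ∧ r + r + r < ε := by
  obtain ⟨r, hr0, hr⟩ := ENNReal.lt_iff_exists_nnreal_btwn.1 hε
  refine ⟨(r / 3 : NNReal), ?_, ?_⟩
  · have : 0 < r := by exact_mod_cast hr0
    exact_mod_cast (by positivity : 0 < r / 3)
  · refine lt_of_eq_of_lt ?_ hr
    norm_cast
    rw [← add_div, ← add_div]
    field_simp
    ring

theorem edist_le_add_add {E : Type*} [PseudoEMetricSpace E] {a b c d : E} {r s t : ℝ≥0∞}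
    (h1 : edist a b ≤ r) (h2 : edist b c ≤ s) (h3 : edist c d ≤ t) : edist a d ≤ r + s + t :=
  (edist_triangle4 a b c d).trans (add_le_add (add_le_add h1 h2) h3)

theorem edist_le_add_of_edist_le {E : Type*} [PseudoEMetricSpace E] {a b c : E} {r s : ℝ≥0∞}
    (h1 : edist a b ≤ r) (h2 : edist b c ≤ s) : edist a c ≤ r + s :=
  (edist_triangle a b c).trans (add_le_add h1 h2)

/-! ### Partitions and the compactness criterion -/

namespace Cadlag

/-- `x` oscillates by at most `ε` on the intervals `[τ i, τ (i+1))` of a grid with mesh at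
least `δ`. -/
structure IsPartition {E : Type*} [PseudoEMetricSpace E] (x : Cadlag E) (ε : ℝ≥0∞) (δ : ℝ)
    (τ : ℕ → unitInterval) : Prop where
  isGrid : IsGrid δ τ
  osc : ∀ i u, τ i ≤ u → u < τ (i + 1) → edist (x u) (x (τ i)) ≤ ε

/-- The existence of a partition with mesh at least `δ` and oscillation at most `ε`. -/
def HasPartition {E : Type*} [PseudoEMetricSpace E] (x : Cadlag E) (ε : ℝ≥0∞) (δ : ℝ) : Prop :=
  ∃ τ, x.IsPartition ε δ τ

theorem HasPartition.mono {E : Type*} [PseudoEMetricSpace E] {x : Cadlag E} {ε ε' : ℝ≥0∞}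
    {δ δ' : ℝ} (h : x.HasPartition ε δ) (hε : ε ≤ ε') (hδ : δ' ≤ δ) : x.HasPartition ε' δ' := by
  obtain ⟨τ, h⟩ := h
  exact ⟨τ, h.isGrid.of_le hδ, fun i u h1 h2 => (h.osc i u h1 h2).trans hε⟩

/-- A function with values in a compact set which is approximated at every scale by step functions
on the half-open intervals of a grid is càdlàg. -/
theorem exists_coe_eq_of_grid {E : Type*} [PseudoEMetricSpace E] {C : Set E} (hC : IsCompact C)
    {x : unitInterval → E} (hxC : ∀ t, x t ∈ C)
    (h : ∀ ε : ℝ≥0∞, 0 < ε → ∃ (δ : ℝ) (σ : ℕ → unitInterval) (N : ℕ) (c : ℕ → E), IsGrid δ σ ∧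
      σ N = 1 ∧ ∀ i < N, ∀ t, σ i ≤ t → t < σ (i + 1) → edist (x t) (c i) ≤ ε) :
    ∃ y : Cadlag E, ⇑y = x := by
  refine ⟨⟨x, fun t => ?_, fun t ht => ?_⟩, rfl⟩
  · rcases (unitInterval.le_one' : t ≤ 1).eq_or_lt with rfl | ht
    · have : Set.Ici (1 : unitInterval) = {1} := Set.Ici_top
      rw [this]
      exact continuousWithinAt_singleton
    rw [ContinuousWithinAt, EMetric.tendsto_nhds]
    intro ε hε
    obtain ⟨r, hr, hrε⟩ := exists_add_add_lt hε
    obtain ⟨δ, σ, N, c, hσ, hN, hc⟩ := h r hr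
    obtain ⟨i, hi, h1, h2⟩ := hσ.exists_mem_Ico hN ht
    filter_upwards [self_mem_nhdsWithin, mem_nhdsWithin_of_mem_nhds (Iio_mem_nhds h2)] with u hu hu2
    have := edist_le_add_of_edist_le (hc i hi u (h1.trans hu) hu2)
      (edist_comm (x t) (c i) ▸ hc i hi t h1 h2)
    exact (this.trans le_self_add).trans_lt hrε
  · have hne : NeBot (𝓝[<] t) := nhdsLT_neBot_of_exists_lt ⟨0, ht⟩
    -- Compactness supplies a candidate for the left limit along one ultrafilter. Smallness of the
    -- oscillation to the left of `t` then makes it the limit along the whole filter.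
    obtain ⟨l, -, hl⟩ := isCompact_iff_ultrafilter_le_nhds'.1 hC
      ((Ultrafilter.of (𝓝[<] t)).map x) (Filter.mem_map.2 (Eventually.of_forall hxC))
    have hof : (Ultrafilter.of (𝓝[<] t) : Filter unitInterval) ≤ 𝓝[<] t := Ultrafilter.of_le _
    have hl' : Tendsto x (Ultrafilter.of (𝓝[<] t)) (𝓝 l) := hl
    refine ⟨l, EMetric.tendsto_nhds.2 fun ε hε => ?_⟩
    obtain ⟨r, hr, hrε⟩ := exists_add_add_lt hε
    obtain ⟨δ, σ, N, c, hσ, hN, hc⟩ := h r hr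
    obtain ⟨i, hi, h1, h2⟩ := hσ.exists_mem_Ioc hN ht
    have hev : ∀ᶠ u in 𝓝[<] t, edist (x u) (c i) ≤ r := by
      filter_upwards [self_mem_nhdsWithin, mem_nhdsWithin_of_mem_nhds (Ioi_mem_nhds h1)]
        with u hu hu1
      exact hc i hi u (le_of_lt hu1) (lt_of_lt_of_le hu h2)
    have hlc : edist l (c i) ≤ r :=
      le_of_tendsto (hl'.edist tendsto_const_nhds) (hof hev)
    filter_upwards [hev] with u hu
    have := edist_le_add_of_edist_le hu (edist_comm l (c i) ▸ hlc)
    exact (this.trans le_self_add).trans_lt hrε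

/-- Along an ultrafilter of functions with values in a compact set, the nodes of partitions and the
values at these nodes converge. -/
theorem exists_limit_partition {E : Type*} [PseudoEMetricSpace E] {C : Set E} (hC : IsCompact C)
    {F : Ultrafilter (Cadlag E)} (hFC : ∀ᶠ y in (F : Filter (Cadlag E)), ∀ t, y t ∈ C) {ε : ℝ≥0∞}
    {δ : ℝ} (hF : ∀ᶠ y in (F : Filter (Cadlag E)), y.HasPartition ε δ) :
    ∃ (τ : Cadlag E → ℕ → unitInterval) (σ : ℕ → unitInterval) (c : ℕ → E),
      (∀ᶠ y in (F : Filter (Cadlag E)), y.IsPartition ε δ (τ y)) ∧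
      (∀ i, Tendsto (fun y => τ y i) F (𝓝 (σ i))) ∧
      ∀ i, Tendsto (fun y : Cadlag E => y (τ y i)) F (𝓝 (c i)) := by
  have h1 : ∀ y : Cadlag E, ∃ τ, y.HasPartition ε δ → y.IsPartition ε δ τ := fun y => by
    by_cases h : y.HasPartition ε δ
    · exact ⟨h.choose, fun _ => h.choose_spec⟩
    · exact ⟨fun _ => 0, fun h' => absurd h' h⟩
  choose τ hτ using h1
  have h2 : ∀ i, ∃ s, Tendsto (fun y => τ y i) F (𝓝 s) := fun i =>
    ⟨_, (F.map (fun y => τ y i)).le_nhds_lim⟩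
  have h3 : ∀ i, ∃ c, Tendsto (fun y : Cadlag E => y (τ y i)) F (𝓝 c) := fun i => by
    obtain ⟨c, -, hc⟩ := isCompact_iff_ultrafilter_le_nhds'.1 hC
      (F.map (fun y : Cadlag E => y (τ y i))) (Filter.mem_map.2 (hFC.mono fun y hy => hy _))
    exact ⟨c, hc⟩
  choose σ hσ using h2
  choose c hc using h3
  exact ⟨τ, σ, c, hF.mono fun y hy => hτ y hy, hσ, hc⟩

/-- Functions whose partitions are close to each other are close in the Skorohod distance. -/
theorem skorohodEDist_le_of_grids {E : Type*} [PseudoEMetricSpace E] {x y : Cadlag E}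
    {δ δ' : ℝ} {σ τ : ℕ → unitInterval} {N : ℕ} {c : ℕ → E} {r : ℝ≥0∞} {η : ℝ} (hσ : IsGrid δ σ)
    (hτ : IsGrid δ' τ) (hσN : σ N = 1) (hτN : τ N = 1)
    (hx : ∀ i < N, ∀ t, σ i ≤ t → t < σ (i + 1) → edist (x t) (c i) ≤ r)
    (hy : ∀ i < N, ∀ t, τ i ≤ t → t < τ (i + 1) → edist (y t) (y (τ i)) ≤ r)
    (hc : ∀ i < N, edist (c i) (y (τ i)) ≤ r) (h1 : edist (x 1) (y 1) ≤ r)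
    (hlow : ∀ i < N, Real.exp (-η) * ((σ (i + 1) : ℝ) - σ i) ≤ τ (i + 1) - τ i)
    (hup : ∀ i < N, (τ (i + 1) : ℝ) - τ i ≤ Real.exp η * ((σ (i + 1) : ℝ) - σ i)) :
    skorohodEDist TimeChange.logSize x y ≤ ENNReal.ofReal η ⊔ (r + r + r) := by
  obtain ⟨l, hl, hlσ⟩ := TimeChange.exists_map_nodes hσ.mono hσ.zero hτ.zero hσN hτN hlow hup
  refine (iInf_le _ l).trans (sup_le_sup hl (iSup_le fun t => ?_))
  rcases (unitInterval.le_one' : t ≤ 1).eq_or_lt with rfl | ht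
  · rw [l.map_one]
    exact h1.trans (le_self_add.trans le_self_add)
  · obtain ⟨i, hi, hit, hti⟩ := hσ.exists_mem_Ico hσN ht
    refine edist_le_add_add (hx i hi t hit hti) (hc i hi) ?_
    rw [edist_comm]
    refine hy i hi _ ?_ ?_
    · rw [← hlσ i hi.le]
      exact l.monotone hit
    · rw [← hlσ (i + 1) hi]
      exact l.strictMono hti

/-- **Compactness criterion**: an ultrafilter of càdlàg functions with values in a compact set and
partitions of uniform mesh converges for the Skorohod distance. -/
theorem exists_tendsto_of_hasPartition {E : Type*} [PseudoEMetricSpace E] {C : Set E}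
    (hC : IsCompact C) {F : Ultrafilter (Cadlag E)}
    (hFC : ∀ᶠ y in (F : Filter (Cadlag E)), ∀ t, y t ∈ C)
    (hF : ∀ ε : ℝ≥0∞, 0 < ε → ∃ δ : ℝ, 0 < δ ∧ ∀ᶠ y in (F : Filter (Cadlag E)),
      y.HasPartition ε δ) :
    ∃ x : Cadlag E, ∀ ε : ℝ≥0∞, 0 < ε → ∀ᶠ y in (F : Filter (Cadlag E)),
      skorohodEDist TimeChange.logSize x y < ε := by
  have hg : ∀ t, ∃ g, g ∈ C ∧ Tendsto (fun y : Cadlag E => y t) F (𝓝 g) := fun t => by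
    obtain ⟨c, hcC, hc⟩ := isCompact_iff_ultrafilter_le_nhds'.1 hC
      (F.map (fun y : Cadlag E => y t)) (Filter.mem_map.2 (hFC.mono fun y hy => hy _))
    exact ⟨c, hcC, hc⟩
  choose g hgC hg using hg
  -- The pointwise limit `g` is controlled only inside the open limit cells, since the nodes move
  -- with `y`. Replacing it by limits from the right extends the control to the left nodes. The end
  -- point 1 has no right neighbourhood and keeps `g 1`.
  have hx : ∀ t, ∃ z, z ∈ C ∧ (t = 1 → z = g 1) ∧ (t < 1 → ∃ G : Ultrafilter unitInterval,
      (G : Filter unitInterval) ≤ 𝓝[>] t ∧ Tendsto g G (𝓝 z)) := fun t => by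
    rcases (unitInterval.le_one' : t ≤ 1).eq_or_lt with rfl | ht
    · exact ⟨g 1, hgC 1, fun _ => rfl, fun h => absurd h (lt_irrefl _)⟩
    · have hne : NeBot (𝓝[>] t) := nhdsGT_neBot_of_exists_gt ⟨1, ht⟩
      obtain ⟨z, hzC, hz⟩ := isCompact_iff_ultrafilter_le_nhds'.1 hC
        ((Ultrafilter.of (𝓝[>] t)).map g) (Filter.mem_map.2 (Eventually.of_forall hgC))
      exact ⟨z, hzC, fun h => absurd h ht.ne, fun _ => ⟨_, Ultrafilter.of_le _, hz⟩⟩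
  choose x hxC hx1 hx using hx
  -- the data of the limit grid at scale `ε`
  have key : ∀ ε : ℝ≥0∞, 0 < ε → ∃ (δ : ℝ) (τ : Cadlag E → ℕ → unitInterval)
      (σ : ℕ → unitInterval) (N : ℕ) (c : ℕ → E), 0 < δ ∧ IsGrid δ σ ∧ 1 < N * δ ∧
      (∀ᶠ y in (F : Filter (Cadlag E)), y.IsPartition ε δ (τ y)) ∧
      (∀ i, Tendsto (fun y => τ y i) F (𝓝 (σ i))) ∧
      (∀ i, Tendsto (fun y : Cadlag E => y (τ y i)) F (𝓝 (c i))) ∧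
      ∀ i < N, ∀ t, σ i ≤ t → t < σ (i + 1) → edist (x t) (c i) ≤ ε := by
    intro ε hε
    obtain ⟨δ, hδ, hδF⟩ := hF ε hε
    obtain ⟨τ, σ, c, hτ, hσ, hc⟩ := exists_limit_partition hC hFC hδF
    obtain ⟨N, hN⟩ := exists_nat_gt (1 / δ)
    refine ⟨δ, τ, σ, N, c, hδ, IsGrid.of_tendsto (hτ.mono fun y h => h.isGrid) hσ,
      by rwa [div_lt_iff₀ hδ] at hN, hτ, hσ, hc, fun i _ t hit hti => ?_⟩
    have hgc : ∀ u, σ i < u → u < σ (i + 1) → edist (g u) (c i) ≤ ε := by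
      intro u h1 h2
      refine le_of_tendsto ((hg u).edist (hc i)) ?_
      filter_upwards [hτ, (hσ i).eventually (gt_mem_nhds h1),
        (hσ (i + 1)).eventually (lt_mem_nhds h2)] with y hy hy1 hy2
      exact hy.osc i u hy1.le hy2
    obtain ⟨G, hG, hGx⟩ := hx t (hti.trans_le unitInterval.le_one')
    refine le_of_tendsto (hGx.edist tendsto_const_nhds) (hG ?_)
    filter_upwards [self_mem_nhdsWithin, mem_nhdsWithin_of_mem_nhds (Iio_mem_nhds hti)] with u h1 h2
    exact hgc u (lt_of_le_of_lt hit h1) h2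
  obtain ⟨X, hX⟩ := exists_coe_eq_of_grid hC hxC fun ε hε => by
    obtain ⟨δ, τ, σ, N, c, -, hσ, hN, -, -, -, hxc⟩ := key ε hε
    exact ⟨δ, σ, N, c, hσ, hσ.eq_one hN, hxc⟩
  refine ⟨X, fun ε hε => ?_⟩
  obtain ⟨r, hr, hrε⟩ := exists_add_add_lt hε
  obtain ⟨η, hη, hηε⟩ : ∃ η : ℝ, 0 < η ∧ ENNReal.ofReal η < ε := by
    obtain ⟨η, hη0, hη⟩ := ENNReal.lt_iff_exists_nnreal_btwn.1 hε
    exact ⟨η, by exact_mod_cast hη0, by simpa using hη⟩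
  obtain ⟨δ, τ, σ, N, c, hδ, hσ, hN, hτ, hτσ, hτc, hxc⟩ := key r hr
  have hgrid : ∀ᶠ y in (F : Filter (Cadlag E)), IsGrid δ (τ y) := hτ.mono fun y h => h.isGrid
  have e1 : ∀ᶠ y in (F : Filter (Cadlag E)), ∀ i ∈ Finset.range N, edist (c i) (y (τ y i)) ≤ r := by
    refine (Finset.eventually_all _).2 fun i _ => ?_
    filter_upwards [EMetric.tendsto_nhds.1 (hτc i) r hr] with y hy
    rw [edist_comm]
    exact hy.le
  have e2 : ∀ᶠ y in (F : Filter (Cadlag E)), edist (X 1) (y 1) ≤ r := by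
    filter_upwards [EMetric.tendsto_nhds.1 (hg 1) r hr] with y hy
    rw [edist_comm, hX, hx1 1 rfl]
    exact hy.le
  have e3 : ∀ᶠ y in (F : Filter (Cadlag E)), ∀ i ∈ Finset.range N,
      Real.exp (-η) * ((σ (i + 1) : ℝ) - σ i) ≤ τ y (i + 1) - τ y i ∧
      (τ y (i + 1) : ℝ) - τ y i ≤ Real.exp η * ((σ (i + 1) : ℝ) - σ i) := by
    refine (Finset.eventually_all _).2 fun i _ => ?_
    -- If `σ i = 1`, both ends of the cell of `y` are eventually equal to 1 and the inequalities
    -- read `0 ≤ 0`. Otherwise the limit cell has length at least `δ > 0`, and the ratio of lengths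
    -- tends to 1.
    rcases hσ.gap i with h1 | h1
    · have h2 : σ (i + 1) = 1 := le_antisymm unitInterval.le_one' (h1 ▸ hσ.mono i.le_succ)
      filter_upwards [IsGrid.eventually_eq_one hδ hgrid (h1 ▸ hτσ i),
        IsGrid.eventually_eq_one hδ hgrid (h2 ▸ hτσ (i + 1))] with y hy1 hy2
      simp [h1, h2, hy1, hy2]
    · have hd : 0 < (σ (i + 1) : ℝ) - σ i := by linarith
      have hc : ∀ j, Tendsto (fun y => (τ y j : ℝ)) F (𝓝 (σ j : ℝ)) := fun j =>
        (continuous_subtype_val.tendsto _).comp (hτσ j)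
      have ht := (hc (i + 1)).sub (hc i)
      have hlt1 : Real.exp (-η) * ((σ (i + 1) : ℝ) - σ i) < (σ (i + 1) : ℝ) - σ i :=
        mul_lt_of_lt_one_left hd (Real.exp_lt_one_iff.2 (neg_lt_zero.2 hη))
      have hlt2 : (σ (i + 1) : ℝ) - σ i < Real.exp η * ((σ (i + 1) : ℝ) - σ i) :=
        lt_mul_of_one_lt_left hd (Real.one_lt_exp_iff.2 hη)
      filter_upwards [ht.eventually (lt_mem_nhds hlt1), ht.eventually (gt_mem_nhds hlt2)]
        with y hy1 hy2
      exact ⟨hy1.le, hy2.le⟩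
  filter_upwards [hτ, e1, e2, e3] with y hy hy1 hy2 hy3
  refine (skorohodEDist_le_of_grids hσ hy.isGrid (hσ.eq_one hN) (hy.isGrid.eq_one hN)
    (fun i hi t => by rw [hX]; exact hxc i hi t) (fun i _ => hy.osc i)
    (fun i hi => hy1 i (Finset.mem_range.2 hi)) hy2
    (fun i hi => (hy3 i (Finset.mem_range.2 hi)).1)
    (fun i hi => (hy3 i (Finset.mem_range.2 hi)).2)).trans_lt (sup_lt_iff.2 ⟨hηε, hrε⟩)

/-- Smallness for the logarithmic size implies smallness for the uniform size. -/
theorem exists_unifSize_of_logSize {E : Type*} [PseudoEMetricSpace E] {ε : ℝ≥0∞} (hε : 0 < ε) :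
    ∃ ρ : ℝ≥0∞, 0 < ρ ∧ ∀ x y : Cadlag E, skorohodEDist TimeChange.logSize x y < ρ →
      skorohodEDist TimeChange.unifSize x y ≤ ε := by
  obtain ⟨η, hη0, hη⟩ := ENNReal.lt_iff_exists_nnreal_btwn.1 hε
  have hη0' : (0 : ℝ) < η := by exact_mod_cast hη0
  obtain ⟨ρ, hρ, H⟩ := TimeChange.isSize_logSize.control η hη0'
  refine ⟨ρ ⊓ ε, lt_inf_iff.2 ⟨hρ, hε⟩, fun x y h => ?_⟩
  obtain ⟨l, hl⟩ := iInf_lt_iff.1 h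
  rw [sup_lt_iff] at hl
  refine (iInf_le _ l).trans (sup_le (iSup_le fun t => ?_) (hl.2.le.trans inf_le_right))
  have := H l (hl.1.trans_le inf_le_left) t
  rw [edist_dist, Subtype.dist_eq, Real.dist_eq]
  refine (ENNReal.ofReal_le_ofReal this.le).trans ?_
  simpa using hη.le

end Cadlag

/-! ### Relatively compact sets in the two Skorohod spaces -/

/-- Relative compactness in the Skorohod space `D`. -/
theorem SkD.isCompact_closure {A : Set SkD} {M : ℝ} (hM : ∀ x ∈ A, ∀ s, |x s| ≤ M)
    (hA : ∀ ε : ℝ≥0∞, 0 < ε → ∃ δ : ℝ, 0 < δ ∧ ∀ x ∈ A, x.HasPartition ε δ) :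
    IsCompact (closure A) := by
  refine isCompact_closure_of_ultrafilter fun F hF => ?_
  obtain ⟨x, hx⟩ := Cadlag.exists_tendsto_of_hasPartition (isCompact_Icc (a := -M) (b := M))
    (F := F) (mem_of_superset hF fun y hy t => abs_le.1 (hM y hy t)) fun ε hε => by
      obtain ⟨δ, hδ, h⟩ := hA ε hε
      exact ⟨δ, hδ, mem_of_superset hF h⟩
  refine ⟨x, (Metric.nhds_basis_eball.ge_iff).2 fun ε hε => ?_⟩
  filter_upwards [hx ε hε] with y hy
  rw [Metric.mem_eball, edist_comm]
  exact hy

/-- Relative compactness in the Skorohod space `D([0,1]; D)`. -/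
theorem SkDD.isCompact_closure {A : Set SkDD} {C : Set SkD} (hC : IsCompact C)
    (hAC : ∀ x ∈ A, ∀ t, x t ∈ C)
    (hA : ∀ ε : ℝ≥0∞, 0 < ε → ∃ δ : ℝ, 0 < δ ∧ ∀ x ∈ A, x.HasPartition ε δ) :
    IsCompact (closure A) := by
  refine isCompact_closure_of_ultrafilter fun F hF => ?_
  obtain ⟨x, hx⟩ := Cadlag.exists_tendsto_of_hasPartition hC
    (F := F) (mem_of_superset hF fun y hy t => hAC y hy t) fun ε hε => by
      obtain ⟨δ, hδ, h⟩ := hA ε hε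
      exact ⟨δ, hδ, mem_of_superset hF h⟩
  refine ⟨x, (Metric.nhds_basis_closedEBall.ge_iff).2 fun ε hε => ?_⟩
  obtain ⟨ρ, hρ, H⟩ := Cadlag.exists_unifSize_of_logSize (E := SkD) hε
  filter_upwards [hx ρ hρ] with y hy
  rw [Metric.mem_closedEBall, edist_comm]
  exact H x y hy

/-! ### From the three moduli to partitions -/

/-- A subset of `[0,1]` whose points are spaced by at least `d`, and which is away from the end
points of `[0,1]` except possibly for `1`, is contained in the set of nodes of a grid of mesh
between `d / 2` and `d`. -/
theorem exists_isGrid_of_separated {S : Set unitInterval} {d : ℝ} (hd : 0 < d) (hd1 : d ≤ 1)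
    (hsep : ∀ s ∈ S, ∀ v ∈ S, s < v → d ≤ (v : ℝ) - s) (h0 : ∀ s ∈ S, d ≤ s)
    (h1 : ∀ s ∈ S, s = 1 ∨ (s : ℝ) ≤ 1 - d) :
    ∃ τ : ℕ → unitInterval, IsGrid (d / 2) τ ∧ ∀ i, (τ (i + 1) : ℝ) - τ i ≤ d ∧
      ∀ s ∈ S, τ i < s → τ (i + 1) ≤ s := by
  -- Invariant of a greedy construction: from a good point, a step of length `d / 2` passes neither
  -- 1 nor a point of `S`.
  let Good : unitInterval → Prop := fun t =>
    (t : ℝ) ≤ 1 - d / 2 ∧ ∀ s ∈ S, t < s → (t : ℝ) + d / 2 ≤ s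
  have step : ∀ t, ∃ t' : unitInterval, (¬ Good t → t' = 1) ∧ (Good t → (t : ℝ) + d / 2 ≤ t' ∧
      (t' : ℝ) - t ≤ d ∧ (∀ s ∈ S, t < s → t' ≤ s) ∧ (t' = 1 ∨ Good t')) := by
    intro t
    by_cases ht : Good t
    swap
    · exact ⟨1, fun _ => rfl, fun h => absurd h ht⟩
    suffices h : ∃ t' : unitInterval, (t : ℝ) + d / 2 ≤ t' ∧
      (t' : ℝ) - t ≤ d ∧ (∀ s ∈ S, t < s → t' ≤ s) ∧ (t' = 1 ∨ Good t') by
      obtain ⟨t', h⟩ := h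
      exact ⟨t', fun h' => absurd ht h', fun _ => h⟩
    -- A point of `S` other than 1 at distance less than `d` is taken as the next node. If there is
    -- none, the step is `d / 2` while at least `d` remains, and otherwise goes straight to 1.
    by_cases hs : ∃ s ∈ S, t < s ∧ (s : ℝ) < t + d ∧ s ≠ 1
    · obtain ⟨s, hsS, hts, hsd, hs1⟩ := hs
      refine ⟨s, ht.2 s hsS hts, by linarith, fun v hv htv => ?_, Or.inr ⟨?_, fun v hv hsv => ?_⟩⟩
      · by_contra hvs
        have := hsep v hv s hsS (not_le.1 hvs)
        have : (t : ℝ) < v := htv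
        linarith
      · have := (h1 s hsS).resolve_left hs1
        linarith
      · have := hsep s hsS v hv hsv
        linarith
    · have hs' : ∀ s ∈ S, t < s → s = 1 ∨ (t : ℝ) + d ≤ s := by
        intro s hsS hts
        by_contra hcon
        rw [not_or, not_le] at hcon
        exact hs ⟨s, hsS, hts, hcon.2, hcon.1⟩
      rcases le_or_gt (t : ℝ) (1 - d) with htd | htd
      · have hmem : (t : ℝ) + d / 2 ∈ Set.Icc (0 : ℝ) 1 :=
          ⟨by have := t.2.1; linarith, by linarith⟩
        refine ⟨⟨t + d / 2, hmem⟩, le_rfl, by simp only; linarith, fun s hsS hts => ht.2 s hsS hts,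
          Or.inr ⟨by simp only; linarith, fun s hsS hts => ?_⟩⟩
        have hts' : (t : ℝ) + d / 2 < s := hts
        have hts2 : t < s := Subtype.coe_lt_coe.1 (by linarith)
        rcases hs' s hsS hts2 with rfl | h
        · simp only [Set.Icc.coe_one]
          linarith
        · simp only
          linarith
      · refine ⟨1, ?_, ?_, fun s hsS hts => ?_, Or.inl rfl⟩
        · have := ht.1
          simp only [Set.Icc.coe_one]
          linarith
        · simp only [Set.Icc.coe_one]
          linarith
        · rcases hs' s hsS hts with rfl | h
          · exact le_rfl
          · have := s.2.2
            linarith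
  choose f hf1 hf using step
  let τ : ℕ → unitInterval := fun n => f^[n] 0
  have hτs : ∀ n, τ (n + 1) = f (τ n) := fun n => Function.iterate_succ_apply' f n 0
  have hG1 : ¬ Good 1 := fun h => by
    have := h.1
    simp only [Set.Icc.coe_one] at this
    linarith
  have hG0 : Good 0 := ⟨by simp only [Set.Icc.coe_zero]; linarith, fun s hs _ => by
    have := h0 s hs
    simp only [Set.Icc.coe_zero]
    linarith⟩
  have hinv : ∀ n, τ n = 1 ∨ Good (τ n) := by
    intro n
    induction n with
    | zero => exact Or.inr hG0
    | succ n ih =>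
      rw [hτs]
      by_cases h : Good (τ n)
      · exact (hf _ h).2.2.2
      · exact Or.inl (hf1 _ h)
  have hone : ∀ n, τ n = 1 → τ (n + 1) = 1 := fun n h => by
    rw [hτs]
    exact hf1 _ (h ▸ hG1)
  refine ⟨τ, ⟨rfl, monotone_nat_of_le_succ fun n => ?_, fun n => (hinv n).imp_right fun h => ?_⟩,
    fun n => ⟨?_, fun s hs hns => ?_⟩⟩
  · rcases hinv n with h | h
    · rw [h, hone n h]
    · have := (hf _ h).1
      rw [← hτs] at this
      exact Subtype.coe_le_coe.1 (by linarith)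
  · rw [hτs]
    exact (hf _ h).1
  · rcases hinv n with h | h
    · rw [h, hone n h, sub_self]
      exact hd.le
    · rw [hτs]
      exact (hf _ h).2.1
  · rcases hinv n with h | h
    · rw [h] at hns
      exact absurd hns (not_lt.2 unitInterval.le_one')
    · rw [hτs]
      exact (hf _ h).2.2.1 s hs hns

namespace Cadlag

variable {E : Type*}

theorem tendsto_leftLimOne [TopologicalSpace E] (x : Cadlag E) :
    Tendsto x (𝓝[<] 1) (𝓝 x.leftLimOne) :=
  Classical.choose_spec (x.exists_left_limit 1 zero_lt_one)

theorem neBot_nhdsLT_one : NeBot (𝓝[<] (1 : unitInterval)) :=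
  nhdsLT_neBot_of_exists_lt ⟨0, zero_lt_one⟩

variable [PseudoEMetricSpace E] {x : Cadlag E} {ε κ : ℝ≥0∞} {δ : unitInterval}

theorem edist_lt_or_of_wSecond_lt (h : x.wSecond δ < ε) {t₁ t t₂ : unitInterval} (h1 : t₁ ≤ t)
    (h2 : t ≤ t₂) (h3 : (t₂ : ℝ) - t₁ ≤ δ) : edist (x t) (x t₁) < ε ∨ edist (x t₂) (x t) < ε := by
  rw [← inf_lt_iff]
  refine lt_of_le_of_lt ?_ h
  exact le_iSup_of_le t₁ (le_iSup_of_le t (le_iSup_of_le t₂ (le_iSup_of_le ⟨h1, h2, h3⟩ le_rfl)))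

/-- `x` jumps by more than `κ` at `s`. -/
def BigJump (x : Cadlag E) (κ : ℝ≥0∞) (s : unitInterval) : Prop :=
  ∃ r < s, ∀ u, r ≤ u → u < s → κ < edist (x u) (x s)

/-- Just before `s` there is a point at distance more than `κ ≥ ε` from `x s`. So in the minimum
defining `w''` the increment after `s` must be the small one. -/
theorem BigJump.edist_lt {s v : unitInterval} (hs : x.BigJump κ s) (hκ : ε ≤ κ)
    (h : x.wSecond δ < ε) (hsv : s ≤ v) (hv : (v : ℝ) < s + δ) : edist (x v) (x s) < ε := by
  obtain ⟨r, hr, hu⟩ := hs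
  -- The left point must lie in the range where the jump is visible and within `δ` of `v`.
  have hm : max (r : ℝ) (v - δ) < s := max_lt hr (by linarith)
  have hmem : max (r : ℝ) (v - δ) ∈ Set.Icc (0 : ℝ) 1 :=
    ⟨r.2.1.trans (le_max_left _ _), hm.le.trans s.2.2⟩
  have hle : r ≤ ⟨max (r : ℝ) (v - δ), hmem⟩ := Subtype.coe_le_coe.1 (le_max_left _ _)
  have hlt : (⟨max (r : ℝ) (v - δ), hmem⟩ : unitInterval) < s := hm
  refine (edist_lt_or_of_wSecond_lt h hlt.le hsv ?_).resolve_left fun h' => ?_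
  · have := le_max_right (r : ℝ) (v - δ)
    simp only
    linarith
  · have := hu _ hle hlt
    rw [edist_comm] at this
    exact absurd (this.trans h') (not_lt.2 hκ)

/-- If `v` were closer than `δ`, both `x v` and the values just before `v` would be within `ε` of `x
s`, leaving no room for a jump larger than `2ε` at `v`. -/
theorem BigJump.le_sub {s v : unitInterval} (hs : x.BigJump κ s) (hv : x.BigJump κ v)
    (hκ : ε + ε ≤ κ) (h : x.wSecond δ < ε) (hsv : s < v) : (δ : ℝ) ≤ v - s := by
  by_contra! hcon
  obtain ⟨r, hr, hu⟩ := hv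
  have hlt : max r s < v := max_lt hr hsv
  have hlt' : ((max r s : unitInterval) : ℝ) < v := hlt
  have h1 := hu _ (le_max_left r s) hlt
  have hκ' : ε ≤ κ := le_self_add.trans hκ
  have h2 := hs.edist_lt hκ' h (le_max_right r s) (by linarith)
  have h3 := hs.edist_lt hκ' h hsv.le (by linarith)
  rw [edist_comm] at h3
  exact absurd (h1.trans_le ((edist_le_add_of_edist_le h2.le h3.le).trans hκ)) (lt_irrefl _)

/-- Without big jumps, the oscillation over short intervals is small. -/
theorem edist_le_of_not_bigJump (h : x.wSecond δ < ε) {a b u : unitInterval}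
    (hab : (b : ℝ) - a ≤ δ) (hJ : ∀ s, a < s → s < b → ¬ x.BigJump κ s) (hau : a ≤ u)
    (hub : u < b) : edist (x u) (x a) ≤ ε + κ + ε := by
  by_cases hu : edist (x u) (x a) < ε
  · exact hu.le.trans (le_self_add.trans le_self_add)
  -- `sInf S` is the first time the path is at least `ε` away from `x a`. Before it the path is near
  -- `x a`; after it `w''` keeps the path near `x (sInf S)`; the passage itself costs at most `κ`,
  -- as there is no big jump.
  let S : Set unitInterval := {v | a ≤ v ∧ v < b ∧ ε ≤ edist (x v) (x a)}
  have huS : u ∈ S := ⟨hau, hub, not_lt.1 hu⟩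
  have hle : sInf S ≤ u := sInf_le huS
  have has : a ≤ sInf S := le_sInf fun v hv => hv.1
  have hsb : sInf S < b := hle.trans_lt hub
  have hmem : ε ≤ edist (x (sInf S)) (x a) := by
    by_contra! hcon
    have hev : ∀ᶠ v in 𝓝[≥] sInf S, edist (x v) (x a) < ε :=
      ((x.right_continuous (sInf S)).edist continuousWithinAt_const).eventually (gt_mem_nhds hcon)
    obtain ⟨v, hv, hvS⟩ := (mem_nhdsGE_iff_exists_Ico_subset' hsb).1 hev
    refine absurd (le_sInf fun w hw => ?_ : v ≤ sInf S) (not_le.2 hv)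
    by_contra! hwv
    exact absurd (hvS ⟨sInf_le hw, hwv⟩) (not_lt.2 hw.2.2)
  have hbefore : ∀ v, a ≤ v → v < sInf S → edist (x v) (x a) < ε := fun v hav hv => by
    by_contra! hcon
    exact absurd (sInf_le (show v ∈ S from ⟨hav, hv.trans hsb, hcon⟩)) (not_le.2 hv)
  have has' : a < sInf S := by
    refine has.lt_of_ne fun heq => ?_
    rw [← heq, edist_self] at hmem
    exact absurd (h.trans_le hmem) not_lt_zero
  have hlast : edist (x u) (x (sInf S)) < ε :=
    (edist_lt_or_of_wSecond_lt h has hle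
      (by have : (u : ℝ) < b := hub; linarith)).resolve_left (not_lt.2 hmem)
  have hjump := hJ _ has' hsb
  simp only [BigJump, not_exists, not_and, not_forall, not_lt] at hjump
  obtain ⟨v, hav, hv, hvk⟩ := hjump a has'
  rw [edist_comm] at hvk
  exact edist_le_add_add hlast.le hvk (hbefore v hav hv).le

theorem edist_le_of_le_delta (h : x.wSecond δ < ε) (h0 : edist (x δ) (x 0) < ε) {u : unitInterval}
    (hu : u ≤ δ) : edist (x u) (x 0) ≤ ε + ε := by
  rcases edist_lt_or_of_wSecond_lt h unitInterval.nonneg' hu (by simp) with h1 | h1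
  · exact h1.le.trans le_self_add
  · rw [edist_comm] at h1
    exact edist_le_add_of_edist_le h1.le h0.le

/-- If `x u` is not near `x (1 - δ)`, then `w''` keeps all later values near `x u`. The left limit
at 1 is then near `x u`, and it is near `x (1 - δ)` by hypothesis. The value at 1 is excluded
because a jump there is allowed. -/
theorem edist_le_of_symm_delta_le (h : x.wSecond δ < ε)
    (h1 : edist x.leftLimOne (x (unitInterval.symm δ)) < ε) {u : unitInterval}
    (hu : unitInterval.symm δ ≤ u) (hu1 : u < 1) :
    edist (x u) (x (unitInterval.symm δ)) ≤ ε + ε := by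
  by_cases h2 : edist (x u) (x (unitInterval.symm δ)) < ε
  · exact h2.le.trans le_self_add
  have h3 : ∀ v, u ≤ v → edist (x v) (x u) < ε := fun v hv =>
    (edist_lt_or_of_wSecond_lt h hu hv (by
      have := v.2.2
      rw [unitInterval.coe_symm_eq]
      linarith)).resolve_left h2
  have hne := neBot_nhdsLT_one
  have h4 : edist x.leftLimOne (x u) ≤ ε := by
    refine le_of_tendsto (x.tendsto_leftLimOne.edist tendsto_const_nhds) ?_
    filter_upwards [mem_nhdsWithin_of_mem_nhds (Ioi_mem_nhds hu1)] with v hv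
    exact (h3 v (le_of_lt hv)).le
  rw [edist_comm] at h4
  exact edist_le_add_of_edist_le h4 h1.le

/-- The three moduli control the existence of partitions. -/
theorem hasPartition_of_wSecond_lt (hδ : 0 < δ) (h : x.wSecond δ < ε)
    (h0 : edist (x δ) (x 0) < ε) (h1 : edist x.leftLimOne (x (unitInterval.symm δ)) < ε) :
    x.HasPartition (6 * ε) (δ / 2) := by
  -- The threshold is `κ = 4ε`. Separation needs only `2ε`, but near the ends two values may each be
  -- `2ε` from the reference value. The total `ε + κ + ε` is the `6ε` of the conclusion.
  have hκ : ε + ε ≤ ε + ε + (ε + ε) := le_self_add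
  obtain ⟨τ, hτ, hτS⟩ := exists_isGrid_of_separated (S := {s | x.BigJump (ε + ε + (ε + ε)) s})
    (d := δ) hδ δ.2.2 (fun s hs v hv hsv => BigJump.le_sub hs hv hκ h hsv)
    (fun s hs => by
      by_contra! hcon
      obtain ⟨r, hr, hu⟩ := hs
      have hsδ : s ≤ δ := hcon.le
      have h3 := edist_le_of_le_delta h h0 (hr.le.trans hsδ)
      have h4 := edist_le_of_le_delta h h0 hsδ
      rw [edist_comm] at h4
      exact absurd (hu r le_rfl hr) (not_lt.2 (edist_le_add_of_edist_le h3 h4)))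
    (fun s hs => by
      by_contra! hcon
      obtain ⟨r, hr, hu⟩ := hs
      have hs1 : s < 1 := lt_of_le_of_ne unitInterval.le_one' hcon.1
      have hsδ : unitInterval.symm δ < s := by
        rw [← Subtype.coe_lt_coe, unitInterval.coe_symm_eq]
        exact hcon.2
      have hlt : max r (unitInterval.symm δ) < s := max_lt hr hsδ
      have h3 := edist_le_of_symm_delta_le h h1 (le_max_right r _) (hlt.trans hs1)
      have h4 := edist_le_of_symm_delta_le h h1 hsδ.le hs1
      rw [edist_comm] at h4
      exact absurd (hu _ (le_max_left _ _) hlt) (not_lt.2 (edist_le_add_of_edist_le h3 h4)))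
  refine ⟨τ, hτ, fun i u hiu hui => ?_⟩
  refine (edist_le_of_not_bigJump (κ := ε + ε + (ε + ε)) h (hτS i).1 (fun s his hsi hs => ?_) hiu hui).trans_eq ?_
  · exact absurd ((hτS i).2 s hs his) (not_le.2 hsi)
  · ring

end Cadlag

/-! ### Locally uniform properties in the Skorohod distance -/

/-- The predicates `Φ i`, `i` along `F`, eventually hold uniformly near each point. -/
def LocallyUniformly {ι X : Type*} (d : X → X → ℝ≥0∞) (F : Filter ι) (Φ : ι → X → Prop) : Prop :=
  ∀ x, ∃ ρ : ℝ≥0∞, 0 < ρ ∧ ∀ᶠ i in F, ∀ y, d x y < ρ → Φ i y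

namespace Cadlag

theorem exists_of_skorohodEDist_lt {E : Type*} [PseudoEMetricSpace E] {c : TimeChange → ℝ≥0∞}
    {x y : Cadlag E} {ρ : ℝ≥0∞} (h : skorohodEDist c x y < ρ) :
    ∃ l : TimeChange, c l < ρ ∧ ∀ t, edist (x t) (y (l t)) < ρ := by
  obtain ⟨l, hl⟩ := iInf_lt_iff.1 h
  rw [sup_lt_iff] at hl
  exact ⟨l, hl.1, fun t => lt_of_le_of_lt (le_iSup (fun t => edist (x t) (y (l t))) t) hl.2⟩

section

variable {E : Type*} [PseudoEMetricSpace E]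

/-- Near each time, the values of `x` are close to `x t` on the right or to the left limit on the
left. Two balls thus serve a neighbourhood of `t`, and compactness of `[0,1]` leaves finitely many.
-/
theorem exists_uniform_of_locallyUniformly {ι : Type*} {F : Filter ι} {Φ : ι → E → Prop}
    (hΦ : LocallyUniformly edist F Φ) (x : Cadlag E) :
    ∃ ρ : ℝ≥0∞, 0 < ρ ∧ ∀ᶠ i in F, ∀ t, ∀ w, edist (x t) w < ρ → Φ i w := by
  let p : Set unitInterval → Prop := fun S =>
    ∃ ρ : ℝ≥0∞, 0 < ρ ∧ ∀ᶠ i in F, ∀ t ∈ S, ∀ w, edist (x t) w < ρ → Φ i w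
  have hunion : ∀ S T, p S → p T → p (S ∪ T) := by
    rintro S T ⟨ρ, hρ, h⟩ ⟨ρ', hρ', h'⟩
    refine ⟨ρ ⊓ ρ', lt_inf_iff.2 ⟨hρ, hρ'⟩, ?_⟩
    filter_upwards [h, h'] with i hi hi'
    rintro t (ht | ht) w hw
    · exact hi t ht w (hw.trans_le inf_le_left)
    · exact hi' t ht w (hw.trans_le inf_le_right)
  have hlim : ∀ (G : Filter unitInterval) (l : E), Tendsto x G (𝓝 l) → ∃ U ∈ G, p U := by
    intro G l hl
    obtain ⟨ρ, hρ, h⟩ := hΦ l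
    obtain ⟨r, hr, hrρ⟩ := exists_add_add_lt hρ
    refine ⟨_, EMetric.tendsto_nhds.1 hl r hr, r, hr, h.mono fun i hi t ht w hw => hi w ?_⟩
    rw [Set.mem_ofPred_eq, edist_comm] at ht
    exact ((edist_le_add_of_edist_le ht.le hw.le).trans le_self_add).trans_lt hrρ
  have huniv : p Set.univ := by
    refine isCompact_univ.induction_on ⟨1, one_pos, by simp⟩ ?_ hunion fun t _ => ?_
    · rintro S T hST ⟨ρ, hρ, h⟩
      exact ⟨ρ, hρ, h.mono fun i hi t ht => hi t (hST ht)⟩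
    · obtain ⟨U, hU, hpU⟩ := hlim (𝓝[≥] t) _ (x.right_continuous t)
      have : ∃ V ∈ 𝓝[<] t, p V := by
        rcases (unitInterval.nonneg' : 0 ≤ t).eq_or_lt with rfl | ht
        · refine ⟨∅, ?_, 1, one_pos, by simp⟩
          have : Set.Iio (0 : unitInterval) = ∅ := Set.Iio_bot
          rw [this, nhdsWithin_empty]
          exact mem_bot
        · obtain ⟨l, hl⟩ := x.exists_left_limit t ht
          exact hlim _ l hl
      obtain ⟨V, hV, hpV⟩ := this
      refine ⟨V ∪ U, ?_, hunion _ _ hpV hpU⟩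
      rw [nhdsWithin_univ, ← nhdsLT_sup_nhdsGE]
      exact union_mem_sup hV hU
  obtain ⟨ρ, hρ, h⟩ := huniv
  exact ⟨ρ, hρ, h.mono fun i hi t => hi t (Set.mem_univ t)⟩

/-- Locally uniform properties of the values are locally uniform in the Skorohod distance. -/
theorem locallyUniformly_forall {ι : Type*} {F : Filter ι} {Φ : ι → E → Prop}
    (c : TimeChange → ℝ≥0∞) (hΦ : LocallyUniformly edist F Φ) :
    LocallyUniformly (skorohodEDist c) F (fun i (x : Cadlag E) => ∀ t, Φ i (x t)) := by
  intro x
  obtain ⟨ρ, hρ, h⟩ := exists_uniform_of_locallyUniformly hΦ x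
  refine ⟨ρ, hρ, h.mono fun i hi y hy t => ?_⟩
  obtain ⟨l, -, hl⟩ := exists_of_skorohodEDist_lt hy
  have := hl (l.symm t)
  rw [OrderIso.apply_symm_apply] at this
  exact hi _ _ this

/-- Around each `t₀` the path is nearly constant on either side. For a span below the Lebesgue
number of this cover, `t` lies on the same side of some `t₀` as `t₁` or `t₂`. -/
theorem exists_forall_edist_lt_or (x : Cadlag E) {ε : ℝ≥0∞} (hε : 0 < ε) :
    ∃ d : ℝ, 0 < d ∧ ∀ t₁ t t₂ : unitInterval, t₁ ≤ t → t ≤ t₂ → (t₂ : ℝ) - t₁ < d →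
      edist (x t) (x t₁) < ε ∨ edist (x t₂) (x t) < ε := by
  obtain ⟨r, hr, hrε⟩ := exists_add_add_lt hε
  have hloc : ∀ t₀ : unitInterval, ∃ U : Set unitInterval, IsOpen U ∧ t₀ ∈ U ∧
      (∃ l, ∀ u ∈ U, t₀ ≤ u → edist (x u) l < r) ∧ (∃ l, ∀ u ∈ U, u < t₀ → edist (x u) l < r) := by
    intro t₀
    have h1 := EMetric.tendsto_nhds.1 (x.right_continuous t₀) r hr
    have h2 : ∃ l, ∀ᶠ u in 𝓝[<] t₀, edist (x u) l < r := by
      rcases (unitInterval.nonneg' : 0 ≤ t₀).eq_or_lt with rfl | ht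
      · refine ⟨x 0, ?_⟩
        have : Set.Iio (0 : unitInterval) = ∅ := Set.Iio_bot
        rw [this, nhdsWithin_empty]
        exact eventually_bot
      · obtain ⟨l, hl⟩ := x.exists_left_limit t₀ ht
        exact ⟨l, EMetric.tendsto_nhds.1 hl r hr⟩
    obtain ⟨l, h2⟩ := h2
    obtain ⟨U, hU, hUo, hUt⟩ := eventually_nhds_iff.1
      ((eventually_nhdsWithin_iff.1 h1).and (eventually_nhdsWithin_iff.1 h2))
    exact ⟨U, hUo, hUt, ⟨_, fun u hu => (hU u hu).1⟩, ⟨l, fun u hu => (hU u hu).2⟩⟩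
  choose U hUo hUt hright hleft using hloc
  obtain ⟨d, hd, hball⟩ := lebesgue_number_lemma_of_metric (isCompact_univ (X := unitInterval)) hUo
    (fun t _ => Set.mem_iUnion.2 ⟨t, hUt t⟩)
  refine ⟨d, hd, fun t₁ t t₂ h1 h2 h3 => ?_⟩
  obtain ⟨t₀, ht₀⟩ := hball t₁ (Set.mem_univ _)
  have hmem : ∀ u, t₁ ≤ u → u ≤ t₂ → u ∈ U t₀ := fun u hu hu2 => by
    refine ht₀ ?_
    have a1 : (t₁ : ℝ) ≤ u := hu
    have a2 : (u : ℝ) ≤ t₂ := hu2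
    rw [Metric.mem_ball, Subtype.dist_eq, Real.dist_eq, abs_of_nonneg (by linarith)]
    linarith
  have hpair : ∀ {a b l : E}, edist a l < r → edist b l < r → edist a b < ε := by
    intro a b l ha hb
    rw [edist_comm] at hb
    exact ((edist_le_add_of_edist_le ha.le hb.le).trans le_self_add).trans_lt hrε
  rcases le_or_gt t₀ t with h | h
  · obtain ⟨l, hl⟩ := hright t₀
    exact Or.inr (hpair (hl t₂ (hmem _ (h1.trans h2) le_rfl) (h.trans h2)) (hl t (hmem _ h1 h2) h))
  · obtain ⟨l, hl⟩ := hleft t₀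
    exact Or.inl (hpair (hl t (hmem _ h1 h2) h) (hl t₁ (hmem _ le_rfl (h1.trans h2)) (h1.trans_lt h)))

/-- Near `x`, small distances come with time changes that are close to the identity. -/
theorem exists_pos_forall_timeChange {c : TimeChange → ℝ≥0∞} (hc : TimeChange.IsSize c)
    {ε : ℝ≥0∞} (hε : 0 < ε) {a : ℝ} (ha : 0 < a) :
    ∃ ρ : ℝ≥0∞, 0 < ρ ∧ ∀ x y : Cadlag E, skorohodEDist c x y < ρ → ∃ l : TimeChange,
      (∀ t : unitInterval, |(t : ℝ) - l.symm t| < a) ∧ ∀ t, edist (x (l.symm t)) (y t) < ε := by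
  obtain ⟨ρ, hρ, H⟩ := hc.control a ha
  refine ⟨ρ ⊓ ε, lt_inf_iff.2 ⟨hρ, hε⟩, fun x y h => ?_⟩
  obtain ⟨l, hl, hxy⟩ := exists_of_skorohodEDist_lt h
  refine ⟨l, fun t => ?_, fun t => ?_⟩
  · simpa using H l (hl.trans_le inf_le_left) (l.symm t)
  · simpa using (hxy (l.symm t)).trans_le inf_le_right

theorem locallyUniformly_wSecond_lt {c : TimeChange → ℝ≥0∞} (hc : TimeChange.IsSize c)
    {ε : ℝ≥0∞} (hε : 0 < ε) :
    LocallyUniformly (skorohodEDist c) (𝓝[>] 0)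
    (fun δ (x : Cadlag E) => x.wSecond δ < ε) := by
  intro x
  obtain ⟨r, hr, hrε⟩ := exists_add_add_lt hε
  obtain ⟨d, hd, hx⟩ := x.exists_forall_edist_lt_or hr
  obtain ⟨ρ, hρ, H⟩ := exists_pos_forall_timeChange (E := E) hc hr (a := d / 4) (by linarith)
  refine ⟨ρ, hρ, ?_⟩
  -- A span below `d / 2`, with both ends moved by less than `d / 4`, stays below `d`.
  have hev : ∀ᶠ δ : unitInterval in 𝓝[>] 0, (δ : ℝ) < d / 2 := by
    refine mem_nhdsWithin_of_mem_nhds ((continuous_subtype_val.tendsto _).eventually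
      (gt_mem_nhds ?_))
    simpa using hd
  filter_upwards [hev] with δ hδ y hy
  obtain ⟨l, hl, hxy⟩ := H x y hy
  refine lt_of_le_of_lt ?_ hrε
  refine iSup_le fun t₁ => iSup_le fun t => iSup_le fun t₂ => iSup_le fun ht => ?_
  have b1 := abs_lt.1 (hl t₁)
  have b2 := abs_lt.1 (hl t₂)
  have hxy' : ∀ t, edist (y t) (x (l.symm t)) ≤ r := fun t => by
    rw [edist_comm]
    exact (hxy t).le
  rcases hx _ _ _ (l.symm.monotone ht.1) (l.symm.monotone ht.2.1)
    (by linarith [ht.2.2]) with h | h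
  · exact inf_le_left.trans (edist_le_add_add (hxy' t) h.le (hxy t₁).le)
  · exact inf_le_right.trans (edist_le_add_add (hxy' t₂) h.le (hxy t).le)

theorem locallyUniformly_edist_zero_lt {c : TimeChange → ℝ≥0∞} (hc : TimeChange.IsSize c)
    {ε : ℝ≥0∞} (hε : 0 < ε) :
    LocallyUniformly (skorohodEDist c) (𝓝[>] 0)
    (fun δ (x : Cadlag E) => edist (x δ) (x 0) < ε) := by
  intro x
  obtain ⟨r, hr, hrε⟩ := exists_add_add_lt hε
  obtain ⟨a, ha, hxa⟩ := (mem_nhdsGE_iff_exists_Ico_subset' (zero_lt_one (α := unitInterval))).1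
    (EMetric.tendsto_nhds.1 (x.right_continuous 0) r hr)
  have ha0 : (0 : ℝ) < a := ha
  obtain ⟨ρ, hρ, H⟩ := exists_pos_forall_timeChange (E := E) hc hr (a := a / 2) (by linarith)
  refine ⟨ρ, hρ, ?_⟩
  have hev : ∀ᶠ δ : unitInterval in 𝓝[>] 0, (δ : ℝ) < a / 2 := by
    refine mem_nhdsWithin_of_mem_nhds ((continuous_subtype_val.tendsto _).eventually
      (gt_mem_nhds ?_))
    simpa using ha0
  filter_upwards [hev] with δ hδ y hy
  obtain ⟨l, hl, hxy⟩ := H x y hy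
  have b1 := abs_lt.1 (hl δ)
  have h1 : edist (x (l.symm δ)) (x 0) < r :=
    hxa ⟨unitInterval.nonneg', Subtype.coe_lt_coe.1 (by linarith)⟩
  have h2 := hxy 0
  rw [TimeChange.map_zero] at h2
  have h3 := hxy δ
  rw [edist_comm] at h3
  exact (edist_le_add_add h3.le h1.le h2.le).trans_lt hrε

theorem locallyUniformly_edist_leftLimOne_lt {c : TimeChange → ℝ≥0∞} (hc : TimeChange.IsSize c)
    {ε : ℝ≥0∞} (hε : 0 < ε) :
    LocallyUniformly (skorohodEDist c) (𝓝[>] 0)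
    (fun δ (x : Cadlag E) => edist x.leftLimOne (x (unitInterval.symm δ)) < ε) := by
  intro x
  obtain ⟨r, hr, hrε⟩ := exists_add_add_lt hε
  obtain ⟨q, hq, hqr⟩ := exists_add_add_lt hr
  obtain ⟨a, ha, hxa⟩ := (mem_nhdsLT_iff_exists_Ioo_subset' (zero_lt_one (α := unitInterval))).1
    (EMetric.tendsto_nhds.1 x.tendsto_leftLimOne q hq)
  have ha1 : (a : ℝ) < 1 := ha
  obtain ⟨ρ, hρ, H⟩ := exists_pos_forall_timeChange (E := E) hc hr (a := (1 - a) / 2) (by linarith)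
  refine ⟨ρ, hρ, ?_⟩
  have hev : ∀ᶠ δ : unitInterval in 𝓝[>] 0, (δ : ℝ) < (1 - a) / 2 := by
    refine mem_nhdsWithin_of_mem_nhds ((continuous_subtype_val.tendsto _).eventually
      (gt_mem_nhds ?_))
    simpa using ha1
  filter_upwards [hev, self_mem_nhdsWithin] with δ hδ hδ0 y hy
  obtain ⟨l, hl, hxy⟩ := H x y hy
  set p := unitInterval.symm δ with hp
  have hp' : (p : ℝ) = 1 - δ := unitInterval.coe_symm_eq δ
  have hp1 : p < 1 := Subtype.coe_lt_coe.1 (by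
    have : (0 : ℝ) < δ := hδ0
    simp only [Set.Icc.coe_one]
    linarith)
  -- The time change fixes 1, so it carries `[p, 1)` into `(a, 1)`, where `x` is near its left
  -- limit. A possible jump of `x` at 1 is never met.
  have hx : ∀ v, p ≤ v → v < 1 → edist (x (l.symm v)) x.leftLimOne < q := fun v hpv hv => by
    have b1 := abs_lt.1 (hl p)
    have h2 : l.symm v < 1 := by
      rw [← TimeChange.map_one l.symm]
      exact l.symm.strictMono hv
    have h3 : a < l.symm p := Subtype.coe_lt_coe.1 (by linarith)
    exact hxa ⟨h3.trans_le (l.symm.monotone hpv), h2⟩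
  have hy : ∀ v, p ≤ v → v < 1 → edist (y v) (y p) ≤ r + r + r := fun v hpv hv => by
    have h1 := hxy v
    rw [edist_comm] at h1
    have h2 := hx p le_rfl hp1
    rw [edist_comm] at h2
    have h3 := (edist_le_add_of_edist_le (hx v hpv hv).le h2.le).trans (le_self_add.trans hqr.le)
    exact edist_le_add_add h1.le h3 (hxy p).le
  have hne := neBot_nhdsLT_one
  refine lt_of_le_of_lt (le_of_tendsto (y.tendsto_leftLimOne.edist tendsto_const_nhds) ?_) hrε
  filter_upwards [mem_nhdsWithin_of_mem_nhds (Ioi_mem_nhds hp1), self_mem_nhdsWithin] with v hv hv1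
  exact hy v (le_of_lt hv) hv1

end

end Cadlag

/-- The slack 1 in `a - 1` keeps the bound strictly below `a` after taking suprema over both time
parameters. -/
theorem locallyUniformly_abs_le :
    LocallyUniformly edist atTop (fun (a : ℝ) (r : ℝ) => |r| ≤ a - 1) := by
  intro x
  refine ⟨1, one_pos, (eventually_ge_atTop (|x| + 2)).mono fun a ha y hy => ?_⟩
  have h : dist x y < 1 := by
    rw [edist_dist, ← ENNReal.ofReal_one, ENNReal.ofReal_lt_ofReal_iff one_pos] at hy
    exact hy
  rw [Real.dist_eq] at h
  have := abs_sub_abs_le_abs_sub y x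
  rw [abs_sub_comm] at this
  linarith

theorem LocallyUniformly.mono {ι X : Type*} {d : X → X → ℝ≥0∞} {F : Filter ι} {Φ Ψ : ι → X → Prop}
    (h : LocallyUniformly d F Φ) (hΨ : ∀ᶠ i in F, ∀ x, Φ i x → Ψ i x) :
    LocallyUniformly d F Ψ := by
  intro x
  obtain ⟨ρ, hρ, hx⟩ := h x
  refine ⟨ρ, hρ, ?_⟩
  filter_upwards [hx, hΨ] with i hi hi' y hy
  exact hi' y (hi y hy)

theorem LocallyUniformly.and {ι X : Type*} {d : X → X → ℝ≥0∞} {F : Filter ι} {Φ Ψ : ι → X → Prop}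
    (h : LocallyUniformly d F Φ) (h' : LocallyUniformly d F Ψ) :
    LocallyUniformly d F (fun i x => Φ i x ∧ Ψ i x) := by
  intro x
  obtain ⟨ρ, hρ, hx⟩ := h x
  obtain ⟨ρ', hρ', hx'⟩ := h' x
  refine ⟨ρ ⊓ ρ', lt_inf_iff.2 ⟨hρ, hρ'⟩, ?_⟩
  filter_upwards [hx, hx'] with i hi hi' y hy
  exact ⟨hi y (hy.trans_le inf_le_left), hi' y (hy.trans_le inf_le_right)⟩

theorem LocallyUniformly.eventually_forall_mem {ι X : Type*} [PseudoEMetricSpace X] {F : Filter ι}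
    {Φ : ι → X → Prop} (h : LocallyUniformly edist F Φ) {K : Set X} (hK : IsCompact K) :
    ∀ᶠ i in F, ∀ x ∈ K, Φ i x := by
  refine hK.induction_on (p := fun S => ∀ᶠ i in F, ∀ x ∈ S, Φ i x) (by simp)
    (fun S T hST hT => hT.mono fun i hi x hx => hi x (hST hx)) (fun S T hS hT => ?_) fun x _ => ?_
  · filter_upwards [hS, hT] with i hi hi' x hx
    exact hx.elim (hi x) (hi' x)
  · obtain ⟨ρ, hρ, hx⟩ := h x
    refine ⟨Metric.eball x ρ, mem_nhdsWithin_of_mem_nhds (Metric.eball_mem_nhds x hρ), ?_⟩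
    refine hx.mono fun i hi y hy => hi y ?_
    rw [edist_comm]
    exact hy

/-! ### Tightness and locally vanishing events -/

section Measure

variable {X : Type*} [PseudoEMetricSpace X] [MeasurableSpace X]

/-- Under a tight sequence, events that vanish locally uniformly have asymptotically vanishing
probability. -/
theorem tendsto_limsup_zero_of_isTightMeasureSet {P : ℕ → Measure X}
    (hP : IsTightMeasureSet (Set.range P)) {ι : Type*} {F : Filter ι} {A : ι → Set X}
    (hA : LocallyUniformly edist F (fun i x => x ∉ A i)) :
    Tendsto (fun i => limsup (fun n => P n (A i)) atTop) F (𝓝 0) := by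
  refine ENNReal.tendsto_nhds_zero.2 fun ε hε => ?_
  obtain ⟨K, hK, hKP⟩ := isTightMeasureSet_iff_exists_isCompact_measure_compl_le.1 hP ε hε
  refine (hA.eventually_forall_mem hK).mono fun i hi => ?_
  refine limsup_le_of_le (h := Eventually.of_forall fun n => ?_)
  exact (measure_mono fun x hx hxK => hi x hxK hx).trans (hKP _ ⟨n, rfl⟩)

/-- Decreasing events that vanish locally uniformly and are eventually unlikely are uniformly
unlikely along the sequence. -/
theorem exists_forall_measure_le_of_locallyUniformly [BorelSpace X] {P : ℕ → Measure X}
    [∀ n, IsFiniteMeasure (P n)] {B : ℕ → Set X} (hB : Antitone B)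
    (hloc : LocallyUniformly edist atTop (fun k x => x ∉ B k)) {η : ℝ≥0∞} (hη : 0 < η)
    (hlim : ∃ k, ∀ᶠ n in atTop, P n (B k) ≤ η) : ∃ k, ∀ n, P n (B k) ≤ η := by
  -- The sets `B k` need not be measurable, so continuity from above is applied to their closures. A
  -- ball around `x` that misses some `B k` keeps `x` out of its closure.
  have hinter : ⋂ k, closure (B k) = ∅ := by
    refine Set.eq_empty_of_forall_notMem fun x hx => ?_
    obtain ⟨ρ, hρ, h⟩ := hloc x
    obtain ⟨k, hk⟩ := h.exists
    obtain ⟨y, hy, hxy⟩ := EMetric.mem_closure_iff.1 (Set.mem_iInter.1 hx k) ρ hρ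
    exact hk y hxy hy
  have hsingle : ∀ n, ∀ᶠ k in atTop, P n (B k) ≤ η := fun n => by
    have h := tendsto_measure_iInter_atTop (μ := P n) (s := fun k => closure (B k))
      (fun k => isClosed_closure.measurableSet.nullMeasurableSet)
      (fun i j hij => closure_mono (hB hij)) ⟨0, measure_ne_top _ _⟩
    rw [hinter, measure_empty] at h
    filter_upwards [h.eventually (gt_mem_nhds hη)] with k hk
    exact (measure_mono subset_closure).trans hk.le
  obtain ⟨k, hk⟩ := hlim
  obtain ⟨N, hN⟩ := eventually_atTop.1 hk
  -- The finitely many indices below `N` are treated one by one; monotonicity preserves the bound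
  -- for the others.
  obtain ⟨m, hm, hkm⟩ := (((Finset.eventually_all (Finset.range N)).2 fun n _ => hsingle n).and
    (eventually_ge_atTop k)).exists
  refine ⟨m, fun n => ?_⟩
  rcases lt_or_ge n N with h | h
  · exact hm n (Finset.mem_range.2 h)
  · exact (measure_mono (hB hkm)).trans (hN n h)

end Measure

instance neBot_nhdsGT_zero_unitInterval : NeBot (𝓝[>] (0 : unitInterval)) :=
  nhdsGT_neBot_of_exists_gt ⟨1, zero_lt_one⟩

/-- The factor 6 is the loss in `hasPartition_of_wSecond_lt`. -/
theorem exists_six_mul_ofReal_le {ε : ℝ≥0∞} (hε : 0 < ε) :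
    ∃ e : ℝ, 0 < e ∧ 6 * ENNReal.ofReal e ≤ ε := by
  obtain ⟨r, hr, hrε⟩ := exists_add_add_lt hε
  obtain ⟨q, hq, hqr⟩ := ENNReal.lt_iff_exists_nnreal_btwn.1 hr
  have hq0 : (0 : ℝ) < q := by exact_mod_cast hq
  refine ⟨q / 2, by positivity, ?_⟩
  have h6 : 6 * ENNReal.ofReal (q / 2) = q + q + q := by
    rw [show (6 : ℝ≥0∞) = ENNReal.ofReal 6 by simp, ← ENNReal.ofReal_mul (by norm_num),
      show (6 : ℝ) * (q / 2) = ((q + q + q : NNReal) : ℝ) by push_cast; ring,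
      ENNReal.ofReal_coe_nnreal]
    push_cast
    rfl
  rw [h6]
  exact (add_le_add (add_le_add hqr.le hqr.le) hqr.le).trans hrε.le

theorem tendsto_one_div_succ : Tendsto (fun k : ℕ => 1 / ((k : ℝ) + 1)) atTop (𝓝 0) :=
  tendsto_one_div_add_atTop_nhds_zero_nat

namespace Cadlag

/-- The three moduli are small on a common ball for one suitable `δ`, and this already gives
partitions for every mesh up to `δ / 2`. -/
theorem locallyUniformly_hasPartition {E : Type*} [PseudoEMetricSpace E] {c : TimeChange → ℝ≥0∞}
    (hc : TimeChange.IsSize c) {ε : ℝ≥0∞} (hε : 0 < ε) :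
    LocallyUniformly (skorohodEDist c) atTop
      (fun (k : ℕ) (x : Cadlag E) => x.HasPartition ε (1 / ((k : ℝ) + 1))) := by
  intro x
  obtain ⟨e, he, heε⟩ := exists_six_mul_ofReal_le hε
  have he' : 0 < ENNReal.ofReal e := ENNReal.ofReal_pos.2 he
  obtain ⟨ρ, hρ, h⟩ := (((locallyUniformly_wSecond_lt (E := E) hc he').and
    (locallyUniformly_edist_zero_lt hc he')).and (locallyUniformly_edist_leftLimOne_lt hc he')) x
  obtain ⟨δ, h, hδ⟩ := (h.and self_mem_nhdsWithin).exists
  have hδ0 : (0 : ℝ) < δ / 2 := half_pos hδ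
  refine ⟨ρ, hρ, (tendsto_one_div_succ.eventually (gt_mem_nhds hδ0)).mono fun k hk y hy => ?_⟩
  obtain ⟨⟨h1, h2⟩, h3⟩ := h y hy
  exact (hasPartition_of_wSecond_lt hδ h1 h2 h3).mono heε hk.le

end Cadlag

/-- If three families of events are asymptotically unlikely as `δ → 0`, so are the events which are
contained in their union. -/
theorem exists_eventually_measure_le {X : Type*} [MeasurableSpace X] {P : ℕ → Measure X}
    {A₁ A₂ A₃ : unitInterval → Set X} {B : ℕ → Set X}
    (h₁ : Tendsto (fun δ => limsup (fun n => P n (A₁ δ)) atTop) (𝓝[>] 0) (𝓝 0))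
    (h₂ : Tendsto (fun δ => limsup (fun n => P n (A₂ δ)) atTop) (𝓝[>] 0) (𝓝 0))
    (h₃ : Tendsto (fun δ => limsup (fun n => P n (A₃ δ)) atTop) (𝓝[>] 0) (𝓝 0))
    (hB : ∀ δ : unitInterval, 0 < δ → ∃ k, B k ⊆ A₁ δ ∪ A₂ δ ∪ A₃ δ) {η : ℝ≥0∞} (hη : 0 < η) :
    ∃ k, ∀ᶠ n in atTop, P n (B k) ≤ η := by
  obtain ⟨r, hr, hrη⟩ := exists_add_add_lt hη
  obtain ⟨δ, ⟨⟨⟨e1, e2⟩, e3⟩, hδ⟩⟩ := ((((h₁.eventually (gt_mem_nhds hr)).and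
    (h₂.eventually (gt_mem_nhds hr))).and (h₃.eventually (gt_mem_nhds hr))).and
    self_mem_nhdsWithin).exists
  obtain ⟨k, hk⟩ := hB δ hδ
  refine ⟨k, ?_⟩
  filter_upwards [eventually_lt_of_limsup_lt e1, eventually_lt_of_limsup_lt e2,
    eventually_lt_of_limsup_lt e3] with n h1 h2 h3
  refine (measure_mono hk).trans ((measure_union_le _ _).trans ?_)
  exact (add_le_add ((measure_union_le _ _).trans (add_le_add h1.le h2.le)) h3.le).trans hrη.le

/-! ### Tightness from uniform partitions -/

namespace SkDD

theorem abs_le_of_supNorm_lt {x : SkDD} {a : ℝ} (h : ¬ ENNReal.ofReal a ≤ x.supNorm)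
    (t s : unitInterval) : |x t s| ≤ a := by
  have h1 : ‖x t s‖ₑ < ENNReal.ofReal a :=
    lt_of_le_of_lt (le_iSup_of_le t (le_iSup (fun s => ‖x t s‖ₑ) s)) (not_le.1 h)
  rw [Real.enorm_eq_ofReal_abs] at h1
  exact ((ENNReal.ofReal_lt_ofReal_iff_of_nonneg (abs_nonneg _)).1 h1).le

theorem locallyUniformly_supNorm_lt : LocallyUniformly edist atTop
    (fun (a : ℝ) (x : SkDD) => x ∉ {x : SkDD | ENNReal.ofReal a ≤ x.supNorm}) := by
  have h1 : LocallyUniformly edist atTop (fun (a : ℝ) (x : SkD) => ∀ s, |x s| ≤ a - 1) :=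
    Cadlag.locallyUniformly_forall TimeChange.logSize locallyUniformly_abs_le
  have h2 : LocallyUniformly edist atTop
      (fun (a : ℝ) (x : SkDD) => ∀ t, ∀ s, |x t s| ≤ a - 1) :=
    Cadlag.locallyUniformly_forall TimeChange.unifSize h1
  refine h2.mono ((eventually_gt_atTop 0).mono fun a ha x hx => ?_)
  rw [Set.mem_ofPred_eq, not_le]
  refine lt_of_le_of_lt (iSup_le fun t => iSup_le fun s => ?_)
    ((ENNReal.ofReal_lt_ofReal_iff ha).2 (sub_one_lt a))
  rw [Real.enorm_eq_ofReal_abs]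
  exact ENNReal.ofReal_le_ofReal (hx t s)

/-- Locally uniform properties on `D` are locally uniform over the values of functions
in `D([0,1]; D)`. -/
theorem locallyUniformly_not_exists {ι : Type*} {F : Filter ι} {Φ Ψ : ι → SkD → Prop}
    (h : LocallyUniformly (Cadlag.skorohodEDist TimeChange.logSize) F Φ)
    (hΨ : ∀ i x, Φ i x → ¬ Ψ i x) :
    LocallyUniformly edist F (fun i (x : SkDD) => x ∉ {x : SkDD | ∃ t, Ψ i (x t)}) := by
  have h1 : LocallyUniformly edist F (fun i (x : SkDD) => ∀ t, Φ i (x t)) :=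
    Cadlag.locallyUniformly_forall TimeChange.unifSize h
  refine h1.mono (Eventually.of_forall fun i x hx => ?_)
  rintro ⟨t, ht⟩
  exact hΨ i _ (hx t) ht

/-- A bounded set of functions whose values and which themselves have partitions of uniform mesh is
relatively compact. -/
theorem isCompact_closure_of_hasPartition {A : Set SkDD} {M : ℝ}
    (hM : ∀ x ∈ A, ∀ t s, |x t s| ≤ M)
    (hA : ∀ ε : ℝ≥0∞, 0 < ε → ∃ δ : ℝ, 0 < δ ∧ ∀ x ∈ A, ∀ t, (x t).HasPartition ε δ)
    (hA' : ∀ ε : ℝ≥0∞, 0 < ε → ∃ δ : ℝ, 0 < δ ∧ ∀ x ∈ A, x.HasPartition ε δ) :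
    IsCompact (closure A) := by
  have hC : IsCompact (closure {z : SkD | ∃ x ∈ A, ∃ t, x t = z}) := by
    refine SkD.isCompact_closure (M := M) ?_ fun ε hε => ?_
    · rintro z ⟨x, hx, t, rfl⟩ s
      exact hM x hx t s
    · obtain ⟨δ, hδ, h⟩ := hA ε hε
      refine ⟨δ, hδ, ?_⟩
      rintro z ⟨x, hx, t, rfl⟩
      exact h x hx t
  exact SkDD.isCompact_closure hC (fun x hx t => subset_closure ⟨x, hx, t, rfl⟩) hA'

theorem isTightMeasureSet_of_hasPartition {P : ℕ → Measure SkDD}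
    (h1 : ∀ η : ℝ≥0∞, 0 < η → ∃ a : ℝ, ∀ n, P n {x | ENNReal.ofReal a ≤ x.supNorm} ≤ η)
    (h2 : ∀ ε : ℝ≥0∞, 0 < ε → ∀ η : ℝ≥0∞, 0 < η → ∃ k : ℕ, ∀ n,
      P n {x | ∃ t, ¬ (x t).HasPartition ε (1 / ((k : ℝ) + 1))} ≤ η)
    (h3 : ∀ ε : ℝ≥0∞, 0 < ε → ∀ η : ℝ≥0∞, 0 < η → ∃ k : ℕ, ∀ n,
      P n {x | ¬ x.HasPartition ε (1 / ((k : ℝ) + 1))} ≤ η) :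
    IsTightMeasureSet (Set.range P) := by
  refine isTightMeasureSet_iff_exists_isCompact_measure_compl_le.2 fun η hη => ?_
  obtain ⟨r, hr, hrη⟩ := exists_add_add_lt hη
  -- The error `η` is split into three parts of size `r`: one for the norm bound and one for each
  -- family of partition events, in which scale `j` costs at most `ζ j`.
  obtain ⟨ζ, hζ, hζr⟩ := ENNReal.exists_pos_sum_of_countable' hr.ne' ℕ
  have hu : Tendsto (fun j : ℕ => ((j : ℝ≥0∞) + 1)⁻¹) atTop (𝓝 0) := by
    have := (ENNReal.tendsto_inv_nat_nhds_zero).comp (tendsto_add_atTop_nat 1)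
    simpa [Function.comp_def] using this
  have hpos : ∀ j : ℕ, 0 < ((j : ℝ≥0∞) + 1)⁻¹ := fun j => by
    rw [ENNReal.inv_pos]
    simp
  obtain ⟨a, ha⟩ := h1 r hr
  choose k hk using fun j : ℕ => h2 _ (hpos j) _ (hζ j)
  choose m hm using fun j : ℕ => h3 _ (hpos j) _ (hζ j)
  let G : Set SkDD := {x | ¬ ENNReal.ofReal a ≤ x.supNorm ∧
    (∀ (j : ℕ) t, (x t).HasPartition ((j : ℝ≥0∞) + 1)⁻¹ (1 / ((k j : ℝ) + 1))) ∧
    ∀ j : ℕ, x.HasPartition ((j : ℝ≥0∞) + 1)⁻¹ (1 / ((m j : ℝ) + 1))}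
  have hG : IsCompact (closure G) := by
    refine isCompact_closure_of_hasPartition (M := a)
      (fun x hx t s => abs_le_of_supNorm_lt hx.1 t s) (fun ε hε => ?_) fun ε hε => ?_
    · obtain ⟨j, hj⟩ := (hu.eventually (gt_mem_nhds hε)).exists
      exact ⟨_, Nat.one_div_pos_of_nat, fun x hx t => (hx.2.1 j t).mono hj.le le_rfl⟩
    · obtain ⟨j, hj⟩ := (hu.eventually (gt_mem_nhds hε)).exists
      exact ⟨_, Nat.one_div_pos_of_nat, fun x hx => (hx.2.2 j).mono hj.le le_rfl⟩
  refine ⟨closure G, hG, ?_⟩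
  rintro _ ⟨n, rfl⟩
  have hsub : (closure G)ᶜ ⊆ {x | ENNReal.ofReal a ≤ x.supNorm} ∪
      (⋃ j : ℕ, {x : SkDD | ∃ t, ¬ (x t).HasPartition ((j : ℝ≥0∞) + 1)⁻¹ (1 / ((k j : ℝ) + 1))}) ∪
      ⋃ j : ℕ, {x : SkDD | ¬ x.HasPartition ((j : ℝ≥0∞) + 1)⁻¹ (1 / ((m j : ℝ) + 1))} := by
    intro x hx
    by_contra hcon
    simp only [Set.mem_union, Set.mem_iUnion, Set.mem_ofPred_eq, not_or, not_exists, not_not]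
      at hcon
    exact hx (subset_closure ⟨hcon.1.1, hcon.1.2, hcon.2⟩)
  refine (measure_mono hsub).trans ((measure_union_le _ _).trans (le_trans ?_ hrη.le))
  refine add_le_add ((measure_union_le _ _).trans (add_le_add (ha n) ?_)) ?_
  · exact (measure_iUnion_le _).trans ((ENNReal.tsum_le_tsum fun j => hk j n).trans hζr.le)
  · exact (measure_iUnion_le _).trans ((ENNReal.tsum_le_tsum fun j => hm j n).trans hζr.le)

end SkDD

/-! ### The tightness criterion -/

theorem edist_lt_ofReal_iff {a b ε : ℝ} (hε : 0 < ε) :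
    edist a b < ENNReal.ofReal ε ↔ ¬ ε ≤ |a - b| := by
  rw [edist_dist, ENNReal.ofReal_lt_ofReal_iff hε, Real.dist_eq, not_le]

theorem exists_one_div_succ_le (δ : unitInterval) (hδ : 0 < δ) :
    ∃ k : ℕ, 1 / ((k : ℝ) + 1) ≤ δ / 2 := by
  have hδ0 : (0 : ℝ) < δ / 2 := half_pos hδ
  obtain ⟨k, hk⟩ := exists_nat_one_div_lt hδ0
  exact ⟨k, hk.le⟩

theorem mainTheorem7 (P : ℕ → Measure SkDD) [∀ n, IsProbabilityMeasure (P n)] :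
    IsTightMeasureSet (Set.range P) ↔
      -- (i)
      Tendsto (fun a : ℝ =>
        limsup (fun n => P n {x | ENNReal.ofReal a ≤ x.supNorm}) atTop) atTop (𝓝 0) ∧
      -- (ii')
      (∀ ε : ℝ, 0 < ε →
        Tendsto (fun δ : unitInterval =>
          limsup (fun n => P n {x | ∃ t, ENNReal.ofReal ε ≤ (x t).wSecond δ}) atTop)
          (𝓝[>] 0) (𝓝 0) ∧
        Tendsto (fun δ : unitInterval =>
          limsup (fun n => P n {x | ∃ t, ε ≤ |x t δ - x t 0|}) atTop)
          (𝓝[>] 0) (𝓝 0) ∧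
        Tendsto (fun δ : unitInterval =>
          limsup (fun n => P n {x | ∃ t, ε ≤ |(x t).leftLimOne - x t (unitInterval.symm δ)|}) atTop)
          (𝓝[>] 0) (𝓝 0)) ∧
      -- (iii')
      (∀ ε : ℝ, 0 < ε →
        Tendsto (fun δ : unitInterval =>
          limsup (fun n => P n {x | ENNReal.ofReal ε ≤ x.wSecond δ}) atTop)
          (𝓝[>] 0) (𝓝 0) ∧
        Tendsto (fun δ : unitInterval =>
          limsup (fun n => P n {x | ENNReal.ofReal ε ≤ edist (x δ) (x 0)}) atTop)
          (𝓝[>] 0) (𝓝 0) ∧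
        Tendsto (fun δ : unitInterval =>
          limsup (fun n => P n {x | ENNReal.ofReal ε ≤
            edist x.leftLimOne (x (unitInterval.symm δ))}) atTop)
          (𝓝[>] 0) (𝓝 0)) := by
  have hlog := TimeChange.isSize_logSize
  have hunif := TimeChange.isSize_unifSize
  constructor
  · intro hP
    refine ⟨tendsto_limsup_zero_of_isTightMeasureSet hP SkDD.locallyUniformly_supNorm_lt, fun ε hε => ?_, fun ε hε => ?_⟩
    · have hε' : 0 < ENNReal.ofReal ε := ENNReal.ofReal_pos.2 hε
      refine ⟨tendsto_limsup_zero_of_isTightMeasureSet hP ?_, tendsto_limsup_zero_of_isTightMeasureSet hP ?_, tendsto_limsup_zero_of_isTightMeasureSet hP ?_⟩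
      · exact SkDD.locallyUniformly_not_exists (Cadlag.locallyUniformly_wSecond_lt hlog hε')
          fun δ x => not_le.2
      · exact SkDD.locallyUniformly_not_exists (Cadlag.locallyUniformly_edist_zero_lt hlog hε')
          fun δ x => (edist_lt_ofReal_iff hε).1
      · exact SkDD.locallyUniformly_not_exists
          (Cadlag.locallyUniformly_edist_leftLimOne_lt hlog hε') fun δ x => (edist_lt_ofReal_iff hε).1
    · have hε' : 0 < ENNReal.ofReal ε := ENNReal.ofReal_pos.2 hε
      refine ⟨tendsto_limsup_zero_of_isTightMeasureSet hP ?_, tendsto_limsup_zero_of_isTightMeasureSet hP ?_, tendsto_limsup_zero_of_isTightMeasureSet hP ?_⟩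
      · exact (Cadlag.locallyUniformly_wSecond_lt (E := SkD) hunif hε').mono
          (Eventually.of_forall fun δ x => not_le.2)
      · exact (Cadlag.locallyUniformly_edist_zero_lt (E := SkD) hunif hε').mono
          (Eventually.of_forall fun δ x => not_le.2)
      · exact (Cadlag.locallyUniformly_edist_leftLimOne_lt (E := SkD) hunif hε').mono
          (Eventually.of_forall fun δ x => not_le.2)
  · rintro ⟨h1, h2, h3⟩
    have hmesh : Antitone fun k : ℕ => 1 / ((k : ℝ) + 1) := fun i j hij =>
      Nat.one_div_le_one_div hij
    refine SkDD.isTightMeasureSet_of_hasPartition (fun η hη => ?_) (fun ε hε η hη => ?_)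
      fun ε hε η hη => ?_
    · obtain ⟨k, hk⟩ := exists_forall_measure_le_of_locallyUniformly (P := P) (η := η)
        (B := fun k : ℕ => {x | ENNReal.ofReal (k : ℝ) ≤ x.supNorm})
        (fun i j hij x hx => (ENNReal.ofReal_le_ofReal (Nat.cast_le.2 hij)).trans hx)
        (fun x => by
          obtain ⟨ρ, hρ, h⟩ := SkDD.locallyUniformly_supNorm_lt x
          exact ⟨ρ, hρ, tendsto_natCast_atTop_atTop.eventually h⟩) hη
        (by
          obtain ⟨k, hk⟩ := ((h1.comp tendsto_natCast_atTop_atTop).eventually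
            (gt_mem_nhds hη)).exists
          exact ⟨k, (eventually_lt_of_limsup_lt hk).mono fun n hn => hn.le⟩)
      exact ⟨k, hk⟩
    · obtain ⟨e, he, heε⟩ := exists_six_mul_ofReal_le hε
      -- If some `x t` has no partition of mesh `1 / (k + 1) ≤ δ / 2`, one of its three moduli at
      -- `δ` is at least `e`. The three conditions therefore bound the partition event for large
      -- `n`.
      obtain ⟨a1, a2, a3⟩ := h2 e he
      refine exists_forall_measure_le_of_locallyUniformly (P := P)
        (B := fun k : ℕ => {x | ∃ t, ¬ (x t).HasPartition ε (1 / ((k : ℝ) + 1))})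
        (fun i j hij x ⟨t, ht⟩ => ⟨t, fun h => ht (h.mono le_rfl (hmesh hij))⟩)
        (SkDD.locallyUniformly_not_exists (Cadlag.locallyUniformly_hasPartition hlog hε)
          fun k x => not_not.2) hη (exists_eventually_measure_le a1 a2 a3 (fun δ hδ => ?_) hη)
      obtain ⟨k, hk⟩ := exists_one_div_succ_le δ hδ
      refine ⟨k, fun x ⟨t, ht⟩ => ?_⟩
      by_contra hcon
      simp only [Set.mem_union, Set.mem_ofPred_eq, not_or, not_exists] at hcon
      exact ht ((Cadlag.hasPartition_of_wSecond_lt hδ (not_le.1 (hcon.1.1 t))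
        ((edist_lt_ofReal_iff he).2 (hcon.1.2 t))
        ((edist_lt_ofReal_iff he).2 (hcon.2 t))).mono heε hk)
    · obtain ⟨e, he, heε⟩ := exists_six_mul_ofReal_le hε
      obtain ⟨a1, a2, a3⟩ := h3 e he
      refine exists_forall_measure_le_of_locallyUniformly (P := P)
        (B := fun k : ℕ => {x | ¬ x.HasPartition ε (1 / ((k : ℝ) + 1))})
        (fun i j hij x hx h => hx (h.mono le_rfl (hmesh hij)))
        ((Cadlag.locallyUniformly_hasPartition (E := SkD) hunif hε).mono
          (Eventually.of_forall fun k x => not_not.2)) hη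
        (exists_eventually_measure_le a1 a2 a3 (fun δ hδ => ?_) hη)
      obtain ⟨k, hk⟩ := exists_one_div_succ_le δ hδ
      refine ⟨k, fun x hx => ?_⟩
      by_contra hcon
      simp only [Set.mem_union, Set.mem_ofPred_eq, not_or] at hcon
      exact hx ((Cadlag.hasPartition_of_wSecond_lt hδ (not_le.1 hcon.1.1) (not_le.1 hcon.1.2)
        (not_le.1 hcon.2)).mono heε hk)
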